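/- Let $g>0$ be the gravitational constant, $\sigma>0$ the surface tension coefficient and $[\![\gamma]\!]\in\mathbb R$ the interfacial energy jump, with $-1\le [\![\gamma]\!]/\sigma\le 1$. Let the wall angles satisfy $\theta_1,\theta_2\in(0,\pi)$ and $\theta_1+\theta_2<\pi$ (obtuse angles are allowed). In polar coordinates centred at the corner, the right wall is the ray $\theta=\theta_2$ and the left wall is the ray $\theta=\pi-\theta_1$. Let $\gamma\in[-\tfrac{\pi}{2},\tfrac{\pi}{2}]$ be determined by $\sin\gamma=-[\![\gamma]\!]/\sigma$, and let $$\psi_1=\gamma+\tfrac{\pi}{2}-\theta_1,\qquad \psi_2=-\gamma-\tfrac{\pi}{2}+\theta_2$$ be the slope angles prescribed for the free surface (traversed from left to right) at the left and at the right wall. Suppose that $\psi_1$ and $\psi_2$ have the same sign, in the sense that $\psi_1\psi_2\ge 0$. Then for every prescribed volume $V>0$ there exist a constant $P_0\in\mathbb R$ and a positive function $\rho\in C^2([\theta_2,\pi-\theta_1])$ that solve the Euler–Lagrange system $$\begin{cases} g\rho^{2}\sin\theta+\sigma\dfrac{\rho}{\sqrt{\rho^2+\rho'^2}}-\sigma\,\partial_\theta\!\left(\dfrac{\rho'}{\sqrt{\rho^2+\rho'^2}}\right)-P_0\,\rho=0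 & \text{on }[\theta_2,\pi-\theta_1],\\[2mm] \dfrac{\rho'}{\sqrt{\rho^2+\rho'^2}}(\theta_2)=-\dfrac{[\![\gamma]\!]}{\sigma},\qquad \dfrac{\rho'}{\sqrt{\rho^2+\rho'^2}}(\pi-\theta_1)=\dfrac{[\![\gamma]\!]}{\sigma}, \end{cases}$$ (derivatives at the end points being one-sided) and satisfy the volume constraint $$\frac12\int_{\theta_2}^{\pi-\theta_1}\rho(\theta)^2\,d\theta=V.$$ -/

import Mathlib

open Set

noncomputable section

namespace InclinedWalls

/-- The angle `γ ∈ [-π/2, π/2]` with `sin γ = -κ / σ`, where `κ` is the interfacial energy jump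
(written `[[γ]]` in the literature) and `σ` the surface tension. -/
def wettingAngle (σ κ : ℝ) : ℝ := Real.arcsin (-κ / σ)

/-- Prescribed slope angle `ψ₁` of the free surface, traversed from the left wall to the right
wall, at its contact point with the left wall. -/
def leftContactAngle (σ κ θ₁ : ℝ) : ℝ := wettingAngle σ κ + Real.pi / 2 - θ₁

/-- Prescribed slope angle `ψ₂` of the free surface, traversed from the left wall to the right
wall, at its contact point with the right wall. -/
def rightContactAngle (σ κ θ₂ : ℝ) : ℝ := -wettingAngle σ κ - Real.pi / 2 + θ₂

/-- Polar angles seen from the corner: the right wall is the ray `θ = θ₂`, the left wall is the ray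
`θ = π - θ₁`. -/
def vesselAngles (θ₁ θ₂ : ℝ) : Set ℝ := Icc θ₂ (Real.pi - θ₁)

/-- The derivative `ρ'` on the closed angular interval (one-sided at the end points). -/
def radialDeriv (θ₁ θ₂ : ℝ) (ρ : ℝ → ℝ) (θ : ℝ) : ℝ := derivWithin ρ (vesselAngles θ₁ θ₂) θ

/-- The arc length element `√(ρ² + ρ'²)`. -/
def lengthElement (θ₁ θ₂ : ℝ) (ρ : ℝ → ℝ) (θ : ℝ) : ℝ :=
  √(ρ θ ^ 2 + radialDeriv θ₁ θ₂ ρ θ ^ 2)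

/-- The quotient `ρ' / √(ρ² + ρ'²)`. -/
def radialSlope (θ₁ θ₂ : ℝ) (ρ : ℝ → ℝ) (θ : ℝ) : ℝ :=
  radialDeriv θ₁ θ₂ ρ θ / lengthElement θ₁ θ₂ ρ θ

/-- `ρ` is a classical solution, positive and `C²` up to the walls, of the Euler–Lagrange system
with multiplier `P₀`, that is, of the stationarity conditions of
`(g/3) ∫ ρ³ sin θ + σ ∫ √(ρ² + ρ'²) - κ (ρ (π - θ₁) + ρ θ₂) - P₀ · (1/2) ∫ ρ²`. -/
structure IsSteadyState (g σ κ θ₁ θ₂ P₀ : ℝ) (ρ : ℝ → ℝ) : Prop where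
  pos : ∀ θ ∈ vesselAngles θ₁ θ₂, 0 < ρ θ
  contDiffOn : ContDiffOn ℝ 2 ρ (vesselAngles θ₁ θ₂)
  euler_lagrange : ∀ θ ∈ vesselAngles θ₁ θ₂,
    g * ρ θ ^ 2 * Real.sin θ + σ * (ρ θ / lengthElement θ₁ θ₂ ρ θ)
      - σ * derivWithin (radialSlope θ₁ θ₂ ρ) (vesselAngles θ₁ θ₂) θ - P₀ * ρ θ = 0
  right_wall : radialSlope θ₁ θ₂ ρ θ₂ = -(κ / σ)
  left_wall : radialSlope θ₁ θ₂ ρ (Real.pi - θ₁) = κ / σ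

/-- The volume `(1/2) ∫ ρ² dθ` enclosed by the surface and the two walls. -/
def volume (θ₁ θ₂ : ℝ) (ρ : ℝ → ℝ) : ℝ := (1 / 2) * ∫ θ in θ₂..(Real.pi - θ₁), ρ θ ^ 2

end InclinedWalls

end

/-! Put `α = γ + π/2`, so that `cos α = κ/σ`, `ψ₁ = α - θ₁` and `ψ₂ = θ₂ - α`. A reflection of the
wedge reduces the claim to `ψ₁, ψ₂ ≤ 0`. The free surface is then sought as a parametrized curve
`(x, y)` with slope angle `ψ`, speed `v` and curvature `(g y - P)/σ`.

With `ω² = g/σ` and speed `v = L / (ω cos (ψ/2))`, the quantity `q = sin (ψ/2)` satisfies the linear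
equation `q'' = L² q`. The contact angles prescribe `q` at both ends, so for each `L > 0` the shape
is an explicit combination of hyperbolic sines. Height and curvature are, up to factors and
constants, the function `p = q'/L`. Translating the arc places its ends on the walls, and the
vertical shift is absorbed by `P`.

The arc is a polar graph if `F = y cos ψ - x sin ψ` is positive. Where `sin ψ ≠ 0`, `F / (-sin ψ)`
is the abscissa at which the tangent line meets the axis `y = 0`. Its derivative has the sign of the
curvature, which decreases along a descending arc, so `F` is controlled by its end values, the radii
times `sin α` (`clockwise_lower_bound`). The resulting bound on `F` also makes the area grow at
least linearly in `L`. Since the area is at most `C L²`, the intermediate value theorem in `L`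
attains every volume (`exists_area_eq`). Passing to polar coordinates
(`CapillaryArc.exists_steadyState`) gives `ρ`. -/

noncomputable section

namespace InclinedWalls

/-! ### From parametrized arcs to polar graphs -/

/-- A function on `[0, 1]` with continuously differentiable negative derivative has a `C²` inverse
on `[f 1, f 0]`. -/
theorem exists_contDiffOn_inverse {f f' : ℝ → ℝ}
    (hf : ∀ r ∈ Icc (0 : ℝ) 1, HasDerivWithinAt f (f' r) (Icc 0 1) r)
    (hneg : ∀ r ∈ Icc (0 : ℝ) 1, f' r < 0) (hf' : ContDiffOn ℝ 1 f' (Icc 0 1)) :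
    f 1 < f 0 ∧ ∃ h : ℝ → ℝ, MapsTo h (Icc (f 1) (f 0)) (Icc 0 1) ∧
      (∀ θ ∈ Icc (f 1) (f 0), f (h θ) = θ) ∧ (∀ r ∈ Icc (0 : ℝ) 1, h (f r) = r) ∧
      (∀ θ ∈ Icc (f 1) (f 0), HasDerivWithinAt h (f' (h θ))⁻¹ (Icc (f 1) (f 0)) θ) ∧
      ContDiffOn ℝ 2 h (Icc (f 1) (f 0)) := by
  have hfc : ContinuousOn f (Icc 0 1) := fun r hr => (hf r hr).continuousWithinAt
  have hanti : StrictAntiOn f (Icc 0 1) := by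
    apply strictAntiOn_of_deriv_neg (convex_Icc 0 1) hfc
    intro r hr
    have hr' : r ∈ Icc (0 : ℝ) 1 := interior_subset hr
    rw [((hf r hr').hasDerivAt (mem_interior_iff_mem_nhds.1 hr)).deriv]
    exact hneg r hr'
  have h0 : (0 : ℝ) ∈ Icc (0 : ℝ) 1 := by simp
  have h1 : (1 : ℝ) ∈ Icc (0 : ℝ) 1 := by simp
  have hlt : f 1 < f 0 := hanti h0 h1 one_pos
  refine ⟨hlt, ?_⟩
  have hsurj : Icc (f 1) (f 0) ⊆ f '' Icc 0 1 := intermediate_value_Icc' zero_le_one hfc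
  have hmaps : MapsTo f (Icc 0 1) (Icc (f 1) (f 0)) := fun r hr =>
    ⟨hanti.antitoneOn hr h1 hr.2, hanti.antitoneOn h0 hr hr.1⟩
  set h := Function.invFunOn f (Icc 0 1) with hh
  have hm : MapsTo h (Icc (f 1) (f 0)) (Icc 0 1) := fun θ hθ =>
    Function.invFunOn_mem (hsurj hθ)
  have hr : ∀ θ ∈ Icc (f 1) (f 0), f (h θ) = θ := fun θ hθ => Function.invFunOn_eq (hsurj hθ)
  have hl : ∀ r ∈ Icc (0 : ℝ) 1, h (f r) = r := fun r hr' =>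
    hanti.injOn (hm (hmaps hr')) hr' (hr _ (hmaps hr'))
  have hc : ContinuousOn h (Icc (f 1) (f 0)) := by
    -- The preimage of a closed set under `h` is the image under `f` of a compact set.
    rw [continuousOn_iff_isClosed]
    intro t ht
    refine ⟨f '' (t ∩ Icc 0 1), ?_, ?_⟩
    · exact ((isCompact_Icc.inter_left ht).image_of_continuousOn
        (hfc.mono inter_subset_right)).isClosed
    · ext θ
      constructor
      · rintro ⟨h2, h3⟩
        exact ⟨⟨h θ, ⟨h2, hm h3⟩, hr θ h3⟩, h3⟩
      · rintro ⟨⟨r, ⟨h2, h3⟩, rfl⟩, h4⟩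
        refine ⟨?_, h4⟩
        rw [mem_preimage, hl r h3]
        exact h2
  have hd : ∀ θ ∈ Icc (f 1) (f 0), HasDerivWithinAt h (f' (h θ))⁻¹ (Icc (f 1) (f 0)) θ := by
    intro θ hθ
    have h2 := ((hf (h θ) (hm hθ)).hasFDerivWithinAt.of_comp_of_leftInverse
      ((hc θ hθ).tendsto_nhdsWithin hm) (hasFDerivWithinAt_id θ _)
      (Filter.eventually_of_mem self_mem_nhdsWithin hr)
      (f'symm := .toSpanSingleton ℝ (f' (h θ))⁻¹)
      (fun _ => by simp [(hneg _ (hm hθ)).ne]) hθ).hasDerivWithinAt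
    simpa using h2
  refine ⟨h, hm, hr, hl, hd, ?_⟩
  have hU : UniqueDiffOn ℝ (Icc (f 1) (f 0)) := uniqueDiffOn_Icc hlt
  have hdw : ∀ θ ∈ Icc (f 1) (f 0), derivWithin h (Icc (f 1) (f 0)) θ = (f' (h θ))⁻¹ :=
    fun θ hθ => (hd θ hθ).derivWithin (hU θ hθ)
  have hdiff : DifferentiableOn ℝ h (Icc (f 1) (f 0)) := fun θ hθ =>
    (hd θ hθ).differentiableWithinAt
  -- Bootstrap: `h' = 1 / f'(h)` is continuous, so `h` is `C¹`; then the right-hand side is `C¹`, so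
  -- `h` is `C²`.
  have hC1 : ContDiffOn ℝ 1 h (Icc (f 1) (f 0)) := by
    rw [contDiffOn_one_iff_derivWithin hU]
    refine ⟨hdiff, ContinuousOn.congr ?_ hdw⟩
    exact (hf'.continuousOn.comp hc hm).inv₀ fun θ hθ => (hneg _ (hm hθ)).ne
  rw [show (2 : WithTop ℕ∞) = 1 + 1 from one_add_one_eq_two.symm,
    contDiffOn_succ_iff_derivWithin hU]
  refine ⟨hdiff, by simp, ContDiffOn.congr ?_ hdw⟩
  exact (hf'.comp hC1 hm).inv fun θ hθ => (hneg _ (hm hθ)).ne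

/-- A regular `C²` curve `(x, y)` over `[0, 1]` in the upper half plane, with tangent direction
`(cos ψ, sin ψ)` and speed `v`, which runs clockwise around the origin, from the ray `θ = π - θ₁` to
the ray `θ = θ₂`, meets both rays at the angle `α`, and whose curvature is
`(g y - P) / σ`. -/
structure CapillaryArc (g σ α θ₁ θ₂ P : ℝ) (x y ψ v : ℝ → ℝ) : Prop where
  contDiffOn_x : ContDiffOn ℝ 2 x (Icc 0 1)
  contDiffOn_y : ContDiffOn ℝ 2 y (Icc 0 1)
  contDiffOn_ψ : ContDiffOn ℝ 1 ψ (Icc 0 1)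
  contDiffOn_v : ContDiffOn ℝ 1 v (Icc 0 1)
  deriv_x : ∀ r ∈ Icc (0 : ℝ) 1, HasDerivWithinAt x (v r * Real.cos (ψ r)) (Icc 0 1) r
  deriv_y : ∀ r ∈ Icc (0 : ℝ) 1, HasDerivWithinAt y (v r * Real.sin (ψ r)) (Icc 0 1) r
  deriv_ψ : ∀ r ∈ Icc (0 : ℝ) 1, HasDerivWithinAt ψ (v r * ((g * y r - P) / σ)) (Icc 0 1) r
  v_pos : ∀ r ∈ Icc (0 : ℝ) 1, 0 < v r
  y_pos : ∀ r ∈ Icc (0 : ℝ) 1, 0 < y r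
  clockwise : ∀ r ∈ Icc (0 : ℝ) 1, 0 < y r * Real.cos (ψ r) - x r * Real.sin (ψ r)
  left_end : ∃ a, 0 < a ∧ x 0 = -a * Real.cos θ₁ ∧ y 0 = a * Real.sin θ₁
  right_end : ∃ b, 0 < b ∧ x 1 = b * Real.cos θ₂ ∧ y 1 = b * Real.sin θ₂
  ψ_zero : ψ 0 = α - θ₁
  ψ_one : ψ 1 = θ₂ - α

theorem arctan_cos_div_sin {θ : ℝ} (h : θ ∈ Ioo 0 Real.pi) :
    Real.arctan (Real.cos θ / Real.sin θ) = Real.pi / 2 - θ := by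
  rw [← Real.cot_eq_cos_div_sin, ← Real.tan_inv_eq_cot, ← Real.tan_pi_div_two_sub,
    Real.arctan_tan] <;>
    linarith [h.1, h.2]

namespace CapillaryArc

variable {g σ α θ₁ θ₂ P : ℝ} {x y ψ v : ℝ → ℝ}

/-- The polar angle decreases strictly along a clockwise arc, so the radius is a function of it. In
these coordinates `ρ' / √(ρ² + ρ'²)` is minus the cosine of the angle between position vector and
tangent: its end values are the wall conditions, and its derivative contains the curvature, which
yields the Euler–Lagrange equation. -/
theorem exists_steadyState {κ : ℝ} (hσ : 0 < σ) (hκ : Real.cos α = κ / σ)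
    (hθ₁ : θ₁ ∈ Ioo 0 Real.pi) (hθ₂ : θ₂ ∈ Ioo 0 Real.pi)
    (h : CapillaryArc g σ α θ₁ θ₂ P x y ψ v) :
    ∃ ρ : ℝ → ℝ, IsSteadyState g σ κ θ₁ θ₂ P ρ ∧ volume θ₁ θ₂ ρ =
      (1 / 2) * ∫ r in (0 : ℝ)..1, (y r * Real.cos (ψ r) - x r * Real.sin (ψ r)) * v r := by
  set I := Icc (0 : ℝ) 1 with hI
  -- `F` and `G` are the components of the position vector along the normal `(-sin ψ, cos ψ)` and
  -- along the tangent.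
  set F : ℝ → ℝ := fun r => y r * Real.cos (ψ r) - x r * Real.sin (ψ r) with hF
  set G : ℝ → ℝ := fun r => x r * Real.cos (ψ r) + y r * Real.sin (ψ r) with hG
  set N : ℝ → ℝ := fun r => x r ^ 2 + y r ^ 2 with hN
  set R : ℝ → ℝ := fun r => √(N r) with hR
  -- This formula for the polar angle is smooth on the whole upper half plane, so obtuse wall angles
  -- need no case distinction.
  set Θ : ℝ → ℝ := fun r => Real.pi / 2 - Real.arctan (x r / y r) with hΘ
  have hFG : ∀ r, F r ^ 2 + G r ^ 2 = N r := by
    intro r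
    simp only [hF, hG, hN]
    linear_combination (x r ^ 2 + y r ^ 2) * Real.sin_sq_add_cos_sq (ψ r)
  have hNpos : ∀ r ∈ I, 0 < N r := fun r hr => by
    have := h.y_pos r hr
    simp only [hN]
    positivity
  have hRpos : ∀ r ∈ I, 0 < R r := fun r hr => Real.sqrt_pos.2 (hNpos r hr)
  have hRsq : ∀ r ∈ I, R r ^ 2 = N r := fun r hr => Real.sq_sqrt (hNpos r hr).le
  have hFpos : ∀ r ∈ I, 0 < F r := h.clockwise
  have hx1 : ContDiffOn ℝ 1 x I := h.contDiffOn_x.of_le one_le_two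
  have hy1 : ContDiffOn ℝ 1 y I := h.contDiffOn_y.of_le one_le_two
  have hFC : ContDiffOn ℝ 1 F I :=
    (hy1.mul h.contDiffOn_ψ.cos).sub (hx1.mul h.contDiffOn_ψ.sin)
  have hN2 : ContDiffOn ℝ 2 N I := (h.contDiffOn_x.pow 2).add (h.contDiffOn_y.pow 2)
  have hR2 : ContDiffOn ℝ 2 R I := hN2.sqrt fun r hr => (hNpos r hr).ne'
  have hΘd : ∀ r ∈ I, HasDerivWithinAt Θ (-(v r * F r / N r)) I r := by
    intro r hr
    have hy := (h.y_pos r hr).ne'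
    have hn := (hNpos r hr).ne'
    have h1 := (((h.deriv_x r hr).fun_div (h.deriv_y r hr) hy).arctan).const_sub (Real.pi / 2)
    refine h1.congr_deriv ?_
    have : 1 + (x r / y r) ^ 2 = N r / y r ^ 2 := by
      simp only [hN]; field_simp; ring
    rw [this]
    simp only [hF]
    field_simp
    try ring
  have hRd : ∀ r ∈ I, HasDerivWithinAt R (v r * G r / R r) I r := by
    intro r hr
    have h1 := (((h.deriv_x r hr).fun_pow 2).fun_add ((h.deriv_y r hr).fun_pow 2)).sqrt
      (hNpos r hr).ne'
    refine h1.congr_deriv ?_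
    have := (hRpos r hr).ne'
    change _ / (2 * R r) = _
    simp only [hG]
    field_simp
    ring
  -- Divided by `Θ' = -(v F / N)` this becomes `R (k + F / N)` with `k` the curvature. The `F / N`
  -- part cancels the term `σ ρ / √(ρ² + ρ'²)`, and `g y - σ k - P = 0` remains.
  have hWd : ∀ r ∈ I, HasDerivWithinAt (fun r => -(G r / R r))
      (-(v r * F r / R r) * ((g * y r - P) / σ + F r / N r)) I r := by
    intro r hr
    have hψ := h.deriv_ψ r hr
    have h1 := ((((h.deriv_x r hr).fun_mul hψ.cos).fun_add
      ((h.deriv_y r hr).fun_mul hψ.sin)).fun_div (hRd r hr) (hRpos r hr).ne').fun_neg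
    refine h1.congr_deriv ?_
    have hRp := (hRpos r hr).ne'
    have hRs := hRsq r hr
    have hfg := hFG r
    have hA : v r * Real.cos (ψ r) * Real.cos (ψ r) +
        x r * (-Real.sin (ψ r) * (v r * ((g * y r - P) / σ))) +
        (v r * Real.sin (ψ r) * Real.sin (ψ r) +
          y r * (Real.cos (ψ r) * (v r * ((g * y r - P) / σ))))
        = v r * (1 + F r * ((g * y r - P) / σ)) := by
      simp only [hF]
      linear_combination v r * Real.sin_sq_add_cos_sq (ψ r)
    rw [hA]
    change -((_ * R r - G r * _) / _) = _
    rw [← hRs] at hfg ⊢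
    generalize (g * y r - P) / σ = k at *
    have : G r ^ 2 = R r ^ 2 - F r ^ 2 := by linarith
    field_simp
    linear_combination v r * this
  have hfC : ContDiffOn ℝ 1 (fun r => -(v r * F r / N r)) I :=
    ((h.contDiffOn_v.mul hFC).div (hN2.of_le one_le_two) fun r hr => (hNpos r hr).ne').neg
  have hneg : ∀ r ∈ I, -(v r * F r / N r) < 0 := fun r hr =>
    neg_lt_zero.2 (div_pos (mul_pos (h.v_pos r hr) (hFpos r hr)) (hNpos r hr))
  obtain ⟨hlt, T, hTm, hΘT, hTΘ, hTd, hT2⟩ := exists_contDiffOn_inverse hΘd hneg hfC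
  obtain ⟨a, ha, hxa, hya⟩ := h.left_end
  obtain ⟨b, hb, hxb, hyb⟩ := h.right_end
  have h0I : (0 : ℝ) ∈ I := by simp [hI]
  have h1I : (1 : ℝ) ∈ I := by simp [hI]
  have hΘ0 : Θ 0 = Real.pi - θ₁ := by
    simp only [hΘ]
    rw [hxa, hya, neg_mul, neg_div, Real.arctan_neg, mul_div_mul_left _ _ ha.ne',
      arctan_cos_div_sin hθ₁]
    ring
  have hΘ1 : Θ 1 = θ₂ := by
    simp only [hΘ]
    rw [hxb, hyb, mul_div_mul_left _ _ hb.ne', arctan_cos_div_sin hθ₂]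
    ring
  have hR0 : R 0 = a := by
    simp only [hR, hN]
    rw [hxa, hya, show (-a * Real.cos θ₁) ^ 2 + (a * Real.sin θ₁) ^ 2 = a ^ 2 by
      linear_combination a ^ 2 * Real.sin_sq_add_cos_sq θ₁, Real.sqrt_sq ha.le]
  have hR1 : R 1 = b := by
    simp only [hR, hN]
    rw [hxb, hyb, show (b * Real.cos θ₂) ^ 2 + (b * Real.sin θ₂) ^ 2 = b ^ 2 by
      linear_combination b ^ 2 * Real.sin_sq_add_cos_sq θ₂, Real.sqrt_sq hb.le]
  have hG0 : G 0 = -a * Real.cos α := by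
    have : α = θ₁ + ψ 0 := by rw [h.ψ_zero]; ring
    simp only [hG]
    rw [this, Real.cos_add, hxa, hya]; ring
  have hG1 : G 1 = b * Real.cos α := by
    have : α = θ₂ - ψ 1 := by rw [h.ψ_one]; ring
    simp only [hG]
    rw [this, Real.cos_sub, hxb, hyb]; ring
  have hT0 : T (Real.pi - θ₁) = 0 := by rw [← hΘ0, hTΘ 0 h0I]
  have hT1 : T θ₂ = 1 := by rw [← hΘ1, hTΘ 1 h1I]
  have hJ : vesselAngles θ₁ θ₂ = Icc (Θ 1) (Θ 0) := by rw [hΘ0, hΘ1, vesselAngles]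
  have hU : UniqueDiffOn ℝ (vesselAngles θ₁ θ₂) := hJ ▸ uniqueDiffOn_Icc hlt
  rw [← hJ] at hTm hΘT hTd hT2
  have hρd : ∀ θ ∈ vesselAngles θ₁ θ₂, radialDeriv θ₁ θ₂ (R ∘ T) θ =
      -(G (T θ) * R (T θ) / F (T θ)) := by
    intro θ hθ
    have hr := hTm hθ
    have h1 := (HasDerivWithinAt.scomp θ (hRd (T θ) hr) (hTd θ hθ) hTm).derivWithin (hU θ hθ)
    rw [radialDeriv, h1, ← hRsq _ hr, smul_eq_mul]
    have h2 := (hRpos _ hr).ne'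
    have h3 := (hFpos _ hr).ne'
    have h4 := (h.v_pos _ hr).ne'
    field_simp
  have hlen : ∀ θ ∈ vesselAngles θ₁ θ₂, lengthElement θ₁ θ₂ (R ∘ T) θ =
      R (T θ) ^ 2 / F (T θ) := by
    intro θ hθ
    have hr := hTm hθ
    have h2 := (hRpos _ hr)
    have h3 := (hFpos _ hr)
    rw [lengthElement, hρd θ hθ]
    have : (R ∘ T) θ ^ 2 + (-(G (T θ) * R (T θ) / F (T θ))) ^ 2 = (R (T θ) ^ 2 / F (T θ)) ^ 2 := by
      have h5 := hFG (T θ)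
      rw [← hRsq _ hr] at h5
      simp only [Function.comp_apply]
      field_simp
      linear_combination h5
    rw [this, Real.sqrt_sq (by positivity)]
  have hslope : ∀ θ ∈ vesselAngles θ₁ θ₂, radialSlope θ₁ θ₂ (R ∘ T) θ =
      ((fun r => -(G r / R r)) ∘ T) θ := by
    intro θ hθ
    have hr := hTm hθ
    have h2 := (hRpos _ hr).ne'
    have h3 := (hFpos _ hr).ne'
    rw [radialSlope, hρd θ hθ, hlen θ hθ]
    simp only [Function.comp_apply]
    field_simp
  refine ⟨R ∘ T, ⟨fun θ hθ => hRpos _ (hTm hθ), hR2.comp hT2 hTm, ?_, ?_, ?_⟩, ?_⟩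
  · intro θ hθ
    have hr := hTm hθ
    have h1 := (HasDerivWithinAt.scomp θ (hWd (T θ) hr) (hTd θ hθ) hTm).derivWithin (hU θ hθ)
    rw [derivWithin_congr hslope (hslope θ hθ), h1, hlen θ hθ, smul_eq_mul]
    have h2 := (hRpos _ hr).ne'
    have h3 := (hFpos _ hr).ne'
    have h4 := (h.v_pos _ hr).ne'
    have hsin : R (T θ) * Real.sin θ = y (T θ) := by
      have h5 : Real.sin θ = Real.cos (Real.arctan (x (T θ) / y (T θ))) := by
        rw [← Real.sin_pi_div_two_sub]
        exact congrArg Real.sin (hΘT θ hθ).symm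
      have hy := h.y_pos _ hr
      have h6 : 1 + (x (T θ) / y (T θ)) ^ 2 = (R (T θ) / y (T θ)) ^ 2 := by
        rw [div_pow (R _), hRsq _ hr]
        simp only [hN]; field_simp; ring
      rw [h5, Real.cos_arctan, h6, Real.sqrt_sq (div_pos (hRpos _ hr) hy).le]
      field_simp
    simp only [Function.comp_apply]
    rw [← hRsq _ hr, show g * R (T θ) ^ 2 * Real.sin θ = g * R (T θ) * y (T θ) by
      rw [← hsin]; ring]
    field_simp
    ring
  · have : θ₂ ∈ vesselAngles θ₁ θ₂ := by rw [hJ, hΘ1.symm]; exact left_mem_Icc.2 hlt.le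
    rw [hslope _ this, Function.comp_apply, hT1, hG1, hR1, ← hκ]
    field_simp
  · have : Real.pi - θ₁ ∈ vesselAngles θ₁ θ₂ := by
      rw [hJ, hΘ0.symm]; exact right_mem_Icc.2 hlt.le
    rw [hslope _ this, Function.comp_apply, hT0, hG0, hR0, ← hκ]
    field_simp
  · rw [volume]
    congr 1
    have hcv : ContinuousOn (fun θ => (R ∘ T) θ ^ 2) (Icc (Θ 1) (Θ 0)) := by
      rw [← hJ]
      exact ((hR2.comp hT2 hTm).continuousOn).pow 2
    have hu : uIcc (0 : ℝ) 1 = I := uIcc_of_le zero_le_one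
    have himg : Θ '' I ⊆ Icc (Θ 1) (Θ 0) := by
      rintro _ ⟨r, hr, rfl⟩
      have hanti : AntitoneOn Θ I := by
        apply antitoneOn_of_deriv_nonpos (convex_Icc 0 1)
          (fun r hr => (hΘd r hr).continuousWithinAt)
          (fun r hr => ((hΘd r (interior_subset hr)).differentiableWithinAt).mono interior_subset)
        intro r hr
        have hr' : r ∈ I := interior_subset hr
        rw [((hΘd r hr').hasDerivAt (mem_interior_iff_mem_nhds.1 hr)).deriv]
        exact (hneg r hr').le
      exact ⟨hanti hr h1I hr.2, hanti h0I hr hr.1⟩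
    have h1 := intervalIntegral.integral_comp_mul_deriv'' (a := 0) (b := 1) (f := Θ)
      (f' := fun r => -(v r * F r / N r)) (g := fun θ => (R ∘ T) θ ^ 2)
      (by rw [hu]; exact fun r hr => (hΘd r hr).continuousWithinAt)
      (by
        intro r hr
        rw [min_eq_left zero_le_one, max_eq_right zero_le_one] at hr
        exact ((hΘd r (Ioo_subset_Icc_self hr)).hasDerivAt
          (Icc_mem_nhds hr.1 hr.2)).hasDerivWithinAt)
      (by rw [hu]; exact hfC.continuousOn)
      (by rw [hu]; exact hcv.mono himg)
    rw [hΘ0, hΘ1] at h1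
    rw [intervalIntegral.integral_symm, ← h1, ← intervalIntegral.integral_neg]
    apply intervalIntegral.integral_congr
    intro r hr
    rw [hu] at hr
    have h2 := (hNpos r hr).ne'
    simp only [Function.comp_apply]
    rw [hTΘ r hr, hRsq r hr]
    change _ = F r * v r
    field_simp

end CapillaryArc

/-! ### Descending arcs are star-shaped about the corner -/

/-- A descending curve in the upper half plane whose curvature `k` is decreasing runs clockwise
around the origin if it does so at its end points. -/
theorem clockwise_lower_bound {x y ψ v k : ℝ → ℝ} {c : ℝ}
    (hx : ∀ r ∈ Icc (0 : ℝ) 1, HasDerivWithinAt x (v r * Real.cos (ψ r)) (Icc 0 1) r)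
    (hy : ∀ r ∈ Icc (0 : ℝ) 1, HasDerivWithinAt y (v r * Real.sin (ψ r)) (Icc 0 1) r)
    (hψ : ∀ r ∈ Icc (0 : ℝ) 1, HasDerivWithinAt ψ (v r * k r) (Icc 0 1) r)
    (hv : ∀ r ∈ Icc (0 : ℝ) 1, 0 < v r) (hypos : ∀ r ∈ Icc (0 : ℝ) 1, 0 < y r)
    (hk : AntitoneOn k (Icc 0 1)) (hlow : ∀ r ∈ Icc (0 : ℝ) 1, -Real.pi < ψ r ∧ ψ r ≤ 0)
    (hneg : ∀ r ∈ Ioo (0 : ℝ) 1, ψ r < 0) (hc : 0 < c)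
    (h0 : c ≤ y 0 * Real.cos (ψ 0) - x 0 * Real.sin (ψ 0))
    (h1 : c ≤ y 1 * Real.cos (ψ 1) - x 1 * Real.sin (ψ 1)) :
    ∀ r ∈ Icc (0 : ℝ) 1, 0 < y r * Real.cos (ψ r) - x r * Real.sin (ψ r) ∧
      c * -Real.sin (ψ r) ≤ y r * Real.cos (ψ r) - x r * Real.sin (ψ r) := by
  set F : ℝ → ℝ := fun r => y r * Real.cos (ψ r) - x r * Real.sin (ψ r) with hF
  set S : ℝ → ℝ := fun r => -Real.sin (ψ r) with hS
  have hS0 : ∀ r ∈ Icc (0 : ℝ) 1, 0 ≤ S r := fun r hr =>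
    neg_nonneg.2 (Real.sin_nonpos_of_nonpos_of_neg_pi_le (hlow r hr).2 (hlow r hr).1.le)
  have hS1 : ∀ r, S r ≤ 1 := fun r => by simpa [hS] using neg_le.1 (Real.neg_one_le_sin (ψ r))
  have hSpos : ∀ r ∈ Ioo (0 : ℝ) 1, 0 < S r := fun r hr =>
    neg_pos.2 (Real.sin_neg_of_neg_of_neg_pi_lt (hneg r hr) (hlow r (Ioo_subset_Icc_self hr)).1)
  have hFc : ContinuousOn F (Icc 0 1) := fun r hr =>
    ((hy r hr).continuousWithinAt.mul (hψ r hr).cos.continuousWithinAt).sub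
      ((hx r hr).continuousWithinAt.mul (hψ r hr).sin.continuousWithinAt)
  have hSc : ContinuousOn S (Icc 0 1) := fun r hr => (hψ r hr).sin.continuousWithinAt.neg
  -- `F / S = x - y cot ψ` is the abscissa where the tangent line meets the axis `y = 0`; its
  -- derivative has the sign of `k`.
  have hH : ∀ r ∈ Ioo (0 : ℝ) 1,
      HasDerivAt (fun r => F r / S r) (v r * k r * y r / S r ^ 2) r := by
    intro r hr
    have hn : Icc (0 : ℝ) 1 ∈ nhds r := Icc_mem_nhds hr.1 hr.2
    have hr' := Ioo_subset_Icc_self hr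
    have hψ' := (hψ r hr').hasDerivAt hn
    have h2 := ((((hy r hr').hasDerivAt hn).fun_mul hψ'.cos).fun_sub
      (((hx r hr').hasDerivAt hn).fun_mul hψ'.sin)).fun_div hψ'.sin.fun_neg (hSpos r hr).ne'
    refine h2.congr_deriv ?_
    congr 1
    linear_combination v r * k r * y r * Real.sin_sq_add_cos_sq (ψ r)
  -- Comparison with an end point `e` is stated in product form because `S e` may vanish. With `S e
  -- ≤ 1` it gives `c S r ≤ F e * S r ≤ F r * S e ≤ F r`.
  have hbound : ∀ r ∈ Ioo (0 : ℝ) 1, ∀ e ∈ Icc (0 : ℝ) 1, c ≤ F e → F e * S r ≤ F r * S e →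
      0 < F r ∧ c * S r ≤ F r := by
    intro r hr e he hce hle
    have h2 : c * S r ≤ F e * S r := mul_le_mul_of_nonneg_right hce (hSpos r hr).le
    have h3 : 0 < F r * S e := (mul_pos hc (hSpos r hr)).trans_le (h2.trans hle)
    have h4 : 0 < F r := pos_of_mul_pos_left h3 (hS0 e he)
    exact ⟨h4, (h2.trans hle).trans (mul_le_of_le_one_right h4.le (hS1 e))⟩
  have hend : ∀ e ∈ Icc (0 : ℝ) 1, c ≤ F e → 0 < F e ∧ c * S e ≤ F e := fun e _ hce =>
    ⟨hc.trans_le hce, (mul_le_of_le_one_right hc.le (hS1 e)).trans hce⟩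
  have z0 : (0 : ℝ) ∈ Icc (0 : ℝ) 1 := by simp
  have z1 : (1 : ℝ) ∈ Icc (0 : ℝ) 1 := by simp
  intro r hr
  rcases hr.1.eq_or_lt with rfl | hr0
  · exact hend 0 z0 h0
  rcases hr.2.eq_or_lt with rfl | hr1
  · exact hend 1 z1 h1
  have hr' : r ∈ Ioo (0 : ℝ) 1 := ⟨hr0, hr1⟩
  -- As `k` is antitone, `k r ≥ 0` makes `F / S` increase up to `r`, and `k r ≤ 0` makes it decrease
  -- from `r` on. Either way one end point bounds it from below.
  rcases le_total 0 (k r) with hkr | hkr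
  · have hsub : Icc 0 r ⊆ Icc (0 : ℝ) 1 := Icc_subset_Icc_right hr.2
    have hmono : MonotoneOn (fun r => F r / S r) (Ioc 0 r) := by
      have hio : ∀ t ∈ Ioc 0 r, t ∈ Ioo (0 : ℝ) 1 := fun t ht => ⟨ht.1, ht.2.trans_lt hr1⟩
      apply monotoneOn_of_deriv_nonneg (convex_Ioc 0 r)
        (fun t ht => (hH t (hio t ht)).continuousAt.continuousWithinAt)
        (fun t ht => (hH t (hio t (interior_subset ht))).differentiableAt.differentiableWithinAt)
      intro t ht
      have ht' := hio t (interior_subset ht)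
      have ht2 := Ioo_subset_Icc_self ht'
      rw [(hH t ht').deriv]
      have h2 := hkr.trans (hk ht2 hr (interior_subset ht).2)
      have h3 := hv t ht2
      have h4 := hypos t ht2
      positivity
    have hle : F 0 * S r ≤ F r * S 0 := by
      have hcl : closure (Ioo 0 r) = Icc 0 r := closure_Ioo hr0.ne
      -- The end value is reached by continuity of the product form, since the quotient may be
      -- undefined there.
      refine le_on_closure (s := Ioo 0 r) (f := fun t => F t * S r) (g := fun t => F r * S t)
        ?_ ?_ ?_ (hcl ▸ left_mem_Icc.2 hr0.le)
      · intro t ht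
        have h2 := hmono ⟨ht.1, ht.2.le⟩ ⟨hr0, le_rfl⟩ ht.2.le
        exact (div_le_div_iff₀ (hSpos t ⟨ht.1, ht.2.trans hr1⟩) (hSpos r hr')).1 h2
      · rw [hcl]; exact (hFc.mono hsub).mul continuousOn_const
      · rw [hcl]; exact continuousOn_const.mul (hSc.mono hsub)
    exact hbound r hr' 0 z0 h0 hle
  · have hsub : Icc r 1 ⊆ Icc (0 : ℝ) 1 := Icc_subset_Icc_left hr.1
    have hmono : AntitoneOn (fun r => F r / S r) (Ico r 1) := by
      have hio : ∀ t ∈ Ico r 1, t ∈ Ioo (0 : ℝ) 1 := fun t ht => ⟨hr0.trans_le ht.1, ht.2⟩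
      apply antitoneOn_of_deriv_nonpos (convex_Ico r 1)
        (fun t ht => (hH t (hio t ht)).continuousAt.continuousWithinAt)
        (fun t ht => (hH t (hio t (interior_subset ht))).differentiableAt.differentiableWithinAt)
      intro t ht
      have ht' := hio t (interior_subset ht)
      have ht2 := Ioo_subset_Icc_self ht'
      rw [(hH t ht').deriv]
      have h2 := (hk hr ht2 (interior_subset ht).1).trans hkr
      have h3 := hv t ht2
      have h4 := hypos t ht2
      exact div_nonpos_of_nonpos_of_nonneg
        (mul_nonpos_of_nonpos_of_nonneg (mul_nonpos_of_nonneg_of_nonpos h3.le h2) h4.le)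
        (sq_nonneg _)
    have hle : F 1 * S r ≤ F r * S 1 := by
      have hcl : closure (Ioo r 1) = Icc r 1 := closure_Ioo hr1.ne
      refine le_on_closure (s := Ioo r 1) (f := fun t => F t * S r) (g := fun t => F r * S t)
        ?_ ?_ ?_ (hcl ▸ right_mem_Icc.2 hr1.le)
      · intro t ht
        have h2 := hmono ⟨le_rfl, hr1⟩ ⟨ht.1.le, ht.2⟩ ht.1.le
        exact (div_le_div_iff₀ (hSpos t ⟨hr0.trans ht.1, ht.2⟩) (hSpos r hr')).1 h2
      · rw [hcl]; exact (hFc.mono hsub).mul continuousOn_const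
      · rw [hcl]; exact continuousOn_const.mul (hSc.mono hsub)
    exact hbound r hr' 1 z1 h1 hle

/-! ### The explicit arc: sine of half the slope angle -/

/-- The solution of `q'' = L² q` with `q 0 = q₁` and `q 1 = q₂`; the sine of half the slope angle of
a capillary arc. -/
def sinhProfile (q₁ q₂ L r : ℝ) : ℝ :=
  (q₁ * Real.sinh (L * (1 - r)) + q₂ * Real.sinh (L * r)) / Real.sinh L

/-- The derivative of `sinhProfile`, divided by `L`. -/
def coshProfile (q₁ q₂ L r : ℝ) : ℝ :=
  (-q₁ * Real.cosh (L * (1 - r)) + q₂ * Real.cosh (L * r)) / Real.sinh L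

/-- The slope angle of the capillary arc. -/
def arcAngle (q₁ q₂ L r : ℝ) : ℝ := 2 * Real.arcsin (sinhProfile q₁ q₂ L r)

/-- The speed of the parametrization of the capillary arc (with inverse capillary length `ω`). The
maximum only matters outside of `[0, 1]`. -/
def arcSpeed (ω q₁ q₂ L r : ℝ) : ℝ :=
  L / (ω * √(max (1 - sinhProfile q₁ q₂ L r ^ 2) (1 - max (q₁ ^ 2) (q₂ ^ 2))))

section Profile

variable {ω q₁ q₂ L r : ℝ}

theorem hasDerivAt_sinhProfile :
    HasDerivAt (sinhProfile q₁ q₂ L) (L * coshProfile q₁ q₂ L r) r := by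
  have h1 := (((hasDerivAt_id r).const_sub 1).const_mul L).sinh.const_mul q₁
  have h2 := ((hasDerivAt_id r).const_mul L).sinh.const_mul q₂
  refine ((h1.fun_add h2).div_const (Real.sinh L)).congr_deriv ?_
  simp only [coshProfile, id]
  ring

theorem hasDerivAt_coshProfile :
    HasDerivAt (coshProfile q₁ q₂ L) (L * sinhProfile q₁ q₂ L r) r := by
  have h1 := (((hasDerivAt_id r).const_sub 1).const_mul L).cosh.const_mul (-q₁)
  have h2 := ((hasDerivAt_id r).const_mul L).cosh.const_mul q₂
  refine ((h1.fun_add h2).div_const (Real.sinh L)).congr_deriv ?_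
  simp only [sinhProfile, id]
  ring

theorem contDiff_sinhProfile {n : WithTop ℕ∞} : ContDiff ℝ n (sinhProfile q₁ q₂ L) := by
  unfold sinhProfile
  fun_prop

theorem contDiff_coshProfile {n : WithTop ℕ∞} : ContDiff ℝ n (coshProfile q₁ q₂ L) := by
  unfold coshProfile
  fun_prop

theorem sinhProfile_zero (hL : 0 < L) : sinhProfile q₁ q₂ L 0 = q₁ := by
  have := (Real.sinh_pos_iff.2 hL).ne'
  simp [sinhProfile, this]

theorem sinhProfile_one (hL : 0 < L) : sinhProfile q₁ q₂ L 1 = q₂ := by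
  have := (Real.sinh_pos_iff.2 hL).ne'
  simp [sinhProfile, this]

/-- The total descent of the arc is `2/ω` times this difference; the last factor stays away from
zero for large `L`. -/
theorem coshProfile_zero_sub_one :
    coshProfile q₁ q₂ L 0 - coshProfile q₁ q₂ L 1 =
      (-q₁ - q₂) * ((Real.cosh L - 1) / Real.sinh L) := by
  simp only [coshProfile, sub_zero, sub_self, mul_one, mul_zero, Real.cosh_zero]
  ring

theorem sinhProfile_nonpos (h₁ : q₁ ≤ 0) (h₂ : q₂ ≤ 0) (hL : 0 < L) (hr : r ∈ Icc (0 : ℝ) 1) :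
    sinhProfile q₁ q₂ L r ≤ 0 := by
  refine div_nonpos_of_nonpos_of_nonneg (add_nonpos ?_ ?_) (Real.sinh_nonneg_iff.2 hL.le)
  · exact mul_nonpos_of_nonpos_of_nonneg h₁
      (Real.sinh_nonneg_iff.2 (mul_nonneg hL.le (sub_nonneg.2 hr.2)))
  · exact mul_nonpos_of_nonpos_of_nonneg h₂ (Real.sinh_nonneg_iff.2 (mul_nonneg hL.le hr.1))

theorem sinhProfile_neg (h₁ : q₁ ≤ 0) (h₂ : q₂ ≤ 0) (h : q₁ + q₂ < 0) (hL : 0 < L)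
    (hr : r ∈ Ioo (0 : ℝ) 1) : sinhProfile q₁ q₂ L r < 0 := by
  have ha : 0 < Real.sinh (L * (1 - r)) := Real.sinh_pos_iff.2 (mul_pos hL (sub_pos.2 hr.2))
  have hb : 0 < Real.sinh (L * r) := Real.sinh_pos_iff.2 (mul_pos hL hr.1)
  refine div_neg_of_neg_of_pos ?_ (Real.sinh_pos_iff.2 hL)
  rcases h₁.lt_or_eq with h₁ | rfl
  · exact add_neg_of_neg_of_nonpos (mul_neg_of_neg_of_pos h₁ ha)
      (mul_nonpos_of_nonpos_of_nonneg h₂ hb.le)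
  · rw [zero_mul, zero_add]
    exact mul_neg_of_neg_of_pos (by linarith) hb

/-- By `sinh a + sinh b ≤ sinh (a + b)` for `a, b ≥ 0`, the profile combines its end values with
nonnegative weights of sum at most one; the missing weight is harmless because the minimum is
nonpositive. -/
theorem min_le_sinhProfile (h₁ : q₁ ≤ 0) (hL : 0 < L) (hr : r ∈ Icc (0 : ℝ) 1) :
    min q₁ q₂ ≤ sinhProfile q₁ q₂ L r := by
  have hm : min q₁ q₂ ≤ 0 := min_le_of_left_le h₁
  have ha : 0 ≤ Real.sinh (L * (1 - r)) :=
    Real.sinh_nonneg_iff.2 (mul_nonneg hL.le (sub_nonneg.2 hr.2))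
  have hb : 0 ≤ Real.sinh (L * r) := Real.sinh_nonneg_iff.2 (mul_nonneg hL.le hr.1)
  have hs : Real.sinh (L * (1 - r)) + Real.sinh (L * r) ≤ Real.sinh L := by
    have : Real.sinh L = Real.sinh (L * (1 - r) + L * r) := by ring_nf
    rw [this, Real.sinh_add]
    exact add_le_add (le_mul_of_one_le_right ha (Real.one_le_cosh _))
      (le_mul_of_one_le_left hb (Real.one_le_cosh _))
  rw [sinhProfile, le_div_iff₀ (Real.sinh_pos_iff.2 hL)]
  calc min q₁ q₂ * Real.sinh L
      ≤ min q₁ q₂ * (Real.sinh (L * (1 - r)) + Real.sinh (L * r)) :=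
        mul_le_mul_of_nonpos_left hs hm
    _ = min q₁ q₂ * Real.sinh (L * (1 - r)) + min q₁ q₂ * Real.sinh (L * r) := mul_add _ _ _
    _ ≤ _ := add_le_add (mul_le_mul_of_nonneg_right (min_le_left _ _) ha)
        (mul_le_mul_of_nonneg_right (min_le_right _ _) hb)

theorem sinhProfile_sq_le (h₁ : q₁ ≤ 0) (h₂ : q₂ ≤ 0) (hL : 0 < L) (hr : r ∈ Icc (0 : ℝ) 1) :
    sinhProfile q₁ q₂ L r ^ 2 ≤ max (q₁ ^ 2) (q₂ ^ 2) := by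
  have h := sinhProfile_nonpos h₁ h₂ hL hr
  rcases min_le_iff.1 (min_le_sinhProfile (q₂ := q₂) h₁ hL hr) with h' | h'
  · exact le_max_of_le_left (by nlinarith)
  · exact le_max_of_le_right (by nlinarith)

theorem arcSpeed_eq (h₁ : q₁ ≤ 0) (h₂ : q₂ ≤ 0) (hL : 0 < L) (hr : r ∈ Icc (0 : ℝ) 1) :
    arcSpeed ω q₁ q₂ L r = L / (ω * √(1 - sinhProfile q₁ q₂ L r ^ 2)) := by
  rw [arcSpeed, max_eq_left (sub_le_sub_left (sinhProfile_sq_le h₁ h₂ hL hr) 1)]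

theorem div_le_arcSpeed (hω : 0 < ω) (hL : 0 < L) (hq : max (q₁ ^ 2) (q₂ ^ 2) < 1) :
    L / ω ≤ arcSpeed ω q₁ q₂ L r := by
  have h0 : 0 < √(max (1 - sinhProfile q₁ q₂ L r ^ 2) (1 - max (q₁ ^ 2) (q₂ ^ 2))) :=
    Real.sqrt_pos.2 (lt_max_of_lt_right (sub_pos.2 hq))
  refine div_le_div_of_nonneg_left hL.le (mul_pos hω h0) (mul_le_of_le_one_right hω.le ?_)
  exact Real.sqrt_le_one.2
    (max_le (sub_le_self _ (sq_nonneg _)) (sub_le_self _ (le_max_of_le_left (sq_nonneg _))))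

theorem arcSpeed_le (hω : 0 < ω) (hL : 0 < L) (hq : max (q₁ ^ 2) (q₂ ^ 2) < 1) :
    arcSpeed ω q₁ q₂ L r ≤ L / (ω * √(1 - max (q₁ ^ 2) (q₂ ^ 2))) :=
  div_le_div_of_nonneg_left hL.le (mul_pos hω (Real.sqrt_pos.2 (sub_pos.2 hq)))
    (mul_le_mul_of_nonneg_left (Real.sqrt_le_sqrt (le_max_right _ _)) hω.le)

theorem arcSpeed_pos (hω : 0 < ω) (hL : 0 < L) (hq : max (q₁ ^ 2) (q₂ ^ 2) < 1) :
    0 < arcSpeed ω q₁ q₂ L r :=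
  (div_pos hL hω).trans_le (div_le_arcSpeed hω hL hq)

/-- Writing `L = exp t` builds in `L > 0`, so that continuity in the parameter holds on all of `ℝ`.
-/
theorem continuous_sinhProfile_exp :
    Continuous fun z : ℝ × ℝ => sinhProfile q₁ q₂ (Real.exp z.1) z.2 := by
  unfold sinhProfile
  have : ∀ z : ℝ × ℝ, Real.sinh (Real.exp z.1) ≠ 0 := fun z =>
    (Real.sinh_pos_iff.2 (Real.exp_pos _)).ne'
  fun_prop (disch := exact this _)

theorem continuous_coshProfile_exp :
    Continuous fun z : ℝ × ℝ => coshProfile q₁ q₂ (Real.exp z.1) z.2 := by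
  unfold coshProfile
  have : ∀ z : ℝ × ℝ, Real.sinh (Real.exp z.1) ≠ 0 := fun z =>
    (Real.sinh_pos_iff.2 (Real.exp_pos _)).ne'
  fun_prop (disch := exact this _)

theorem continuous_arcAngle_exp :
    Continuous fun z : ℝ × ℝ => arcAngle q₁ q₂ (Real.exp z.1) z.2 :=
  (Real.continuous_arcsin.comp continuous_sinhProfile_exp).const_mul 2

theorem continuous_arcSpeed_exp (hω : 0 < ω) (hq : max (q₁ ^ 2) (q₂ ^ 2) < 1) :
    Continuous fun z : ℝ × ℝ => arcSpeed ω q₁ q₂ (Real.exp z.1) z.2 := by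
  unfold arcSpeed
  refine (Real.continuous_exp.comp continuous_fst).div
    (((continuous_const.sub (continuous_sinhProfile_exp.pow 2)).max continuous_const).sqrt.const_mul ω) ?_
  intro z
  exact (mul_pos hω (Real.sqrt_pos.2 (lt_max_of_lt_right (sub_pos.2 hq)))).ne'

theorem continuous_arcSpeed (hω : 0 < ω) (hL : 0 < L) (hq : max (q₁ ^ 2) (q₂ ^ 2) < 1) :
    Continuous (arcSpeed ω q₁ q₂ L) := by
  have h := (continuous_arcSpeed_exp (q₁ := q₁) (q₂ := q₂) hω hq).comp
    (Continuous.prodMk_right (Real.log L))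
  simpa [Function.comp_def, Real.exp_log hL] using h

theorem continuous_arcAngle : Continuous (arcAngle q₁ q₂ L) :=
  (Real.continuous_arcsin.comp (contDiff_sinhProfile (n := 0)).continuous).const_mul 2

theorem sinhProfile_sq_lt_one (h₁ : q₁ ≤ 0) (h₂ : q₂ ≤ 0) (hq : max (q₁ ^ 2) (q₂ ^ 2) < 1) (hL : 0 < L)
    (hr : r ∈ Icc (0 : ℝ) 1) : sinhProfile q₁ q₂ L r ^ 2 < 1 :=
  (sinhProfile_sq_le h₁ h₂ hL hr).trans_lt hq

theorem neg_one_lt_sinhProfile (h₁ : q₁ ≤ 0) (h₂ : q₂ ≤ 0) (hq : max (q₁ ^ 2) (q₂ ^ 2) < 1) (hL : 0 < L)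
    (hr : r ∈ Icc (0 : ℝ) 1) : -1 < sinhProfile q₁ q₂ L r :=
  (abs_lt.1 (sq_lt_one_iff_abs_lt_one _ |>.1 (sinhProfile_sq_lt_one h₁ h₂ hq hL hr))).1

theorem sinhProfile_lt_one (h₁ : q₁ ≤ 0) (h₂ : q₂ ≤ 0) (hL : 0 < L) (hr : r ∈ Icc (0 : ℝ) 1) : sinhProfile q₁ q₂ L r < 1 :=
  (sinhProfile_nonpos h₁ h₂ hL hr).trans_lt one_pos

theorem sin_arcAngle (h₁ : q₁ ≤ 0) (h₂ : q₂ ≤ 0) (hq : max (q₁ ^ 2) (q₂ ^ 2) < 1) (hL : 0 < L)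
    (hr : r ∈ Icc (0 : ℝ) 1) : Real.sin (arcAngle q₁ q₂ L r) =
    2 * sinhProfile q₁ q₂ L r * √(1 - sinhProfile q₁ q₂ L r ^ 2) := by
  rw [arcAngle, Real.sin_two_mul, Real.sin_arcsin (neg_one_lt_sinhProfile h₁ h₂ hq hL hr).le
    (sinhProfile_lt_one h₁ h₂ hL hr).le, Real.cos_arcsin]

/-- The speed contains `1 / cos (ψ/2)` precisely to cancel a factor of `sin ψ = 2 sin (ψ/2) cos
(ψ/2)`. The height thereby integrates explicitly to a multiple of `coshProfile`. -/
theorem arcSpeed_mul_sin_arcAngle (h₁ : q₁ ≤ 0) (h₂ : q₂ ≤ 0) (hq : max (q₁ ^ 2) (q₂ ^ 2) < 1) (hL : 0 < L)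
    (hr : r ∈ Icc (0 : ℝ) 1) (hω : 0 < ω) :
    arcSpeed ω q₁ q₂ L r * Real.sin (arcAngle q₁ q₂ L r) =
      2 * (L * sinhProfile q₁ q₂ L r) / ω := by
  rw [arcSpeed_eq h₁ h₂ hL hr, sin_arcAngle h₁ h₂ hq hL hr]
  have : 0 < √(1 - sinhProfile q₁ q₂ L r ^ 2) :=
    Real.sqrt_pos.2 (sub_pos.2 (sinhProfile_sq_lt_one h₁ h₂ hq hL hr))
  field_simp

/-- From `q' = (1/2) cos (ψ/2) ψ'` and `q' = L p`: the curvature is `2 ω p`. -/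
theorem hasDerivAt_arcAngle (h₁ : q₁ ≤ 0) (h₂ : q₂ ≤ 0) (hq : max (q₁ ^ 2) (q₂ ^ 2) < 1) (hL : 0 < L)
    (hr : r ∈ Icc (0 : ℝ) 1) (hω : 0 < ω) : HasDerivAt (arcAngle q₁ q₂ L)
    (arcSpeed ω q₁ q₂ L r * (2 * ω * coshProfile q₁ q₂ L r)) r := by
  have h := ((Real.hasDerivAt_arcsin (neg_one_lt_sinhProfile h₁ h₂ hq hL hr).ne'
    (sinhProfile_lt_one h₁ h₂ hL hr).ne).comp r hasDerivAt_sinhProfile).const_mul 2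
  refine h.congr_deriv ?_
  rw [arcSpeed_eq h₁ h₂ hL hr]
  have : 0 < √(1 - sinhProfile q₁ q₂ L r ^ 2) :=
    Real.sqrt_pos.2 (sub_pos.2 (sinhProfile_sq_lt_one h₁ h₂ hq hL hr))
  field_simp

theorem contDiffOn_arcAngle (h₁ : q₁ ≤ 0) (h₂ : q₂ ≤ 0) (hq : max (q₁ ^ 2) (q₂ ^ 2) < 1) (hL : 0 < L)
    {n : WithTop ℕ∞} : ContDiffOn ℝ n (arcAngle q₁ q₂ L) (Icc 0 1) :=
  fun r hr => (contDiffAt_const.mul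
    ((Real.contDiffAt_arcsin (neg_one_lt_sinhProfile h₁ h₂ hq hL hr).ne'
      (sinhProfile_lt_one h₁ h₂ hL hr).ne).comp r
      contDiff_sinhProfile.contDiffAt)).contDiffWithinAt

theorem contDiffOn_arcSpeed (h₁ : q₁ ≤ 0) (h₂ : q₂ ≤ 0) (hq : max (q₁ ^ 2) (q₂ ^ 2) < 1) (hL : 0 < L)
    (hω : 0 < ω) {n : WithTop ℕ∞} :
    ContDiffOn ℝ n (arcSpeed ω q₁ q₂ L) (Icc 0 1) := by
  refine ContDiffOn.congr ?_ fun r hr => arcSpeed_eq h₁ h₂ hL hr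
  have hpos : ∀ r ∈ Icc (0 : ℝ) 1, 0 < 1 - sinhProfile q₁ q₂ L r ^ 2 := fun r hr =>
    sub_pos.2 (sinhProfile_sq_lt_one h₁ h₂ hq hL hr)
  refine contDiffOn_const.div (contDiffOn_const.mul (ContDiffOn.sqrt
    (contDiffOn_const.sub (contDiff_sinhProfile.contDiffOn.pow 2)) fun r hr => (hpos r hr).ne'))
    fun r hr => (mul_pos hω (Real.sqrt_pos.2 (hpos r hr))).ne'

end Profile

/-! ### Fitting the arc between the walls -/

/-- Horizontal displacement along the capillary arc. -/
def arcWidth (ω q₁ q₂ L r : ℝ) : ℝ :=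
  ∫ s in (0 : ℝ)..r, arcSpeed ω q₁ q₂ L s * Real.cos (arcAngle q₁ q₂ L s)

/-- Vertical displacement along the capillary arc. -/
def arcHeight (ω q₁ q₂ L r : ℝ) : ℝ := 2 * (coshProfile q₁ q₂ L r - coshProfile q₁ q₂ L 0) / ω

/-- Distance of the corner to the left end of the capillary arc. -/
def leftRadius (ω q₁ q₂ θ₁ θ₂ L : ℝ) : ℝ :=
  (arcWidth ω q₁ q₂ L 1 * Real.sin θ₂ - arcHeight ω q₁ q₂ L 1 * Real.cos θ₂) / Real.sin (θ₁ + θ₂)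

/-- Distance of the corner to the right end of the capillary arc. -/
def rightRadius (ω q₁ q₂ θ₁ θ₂ L : ℝ) : ℝ :=
  (arcWidth ω q₁ q₂ L 1 * Real.sin θ₁ + arcHeight ω q₁ q₂ L 1 * Real.cos θ₁) / Real.sin (θ₁ + θ₂)

/-- Abscissa along the capillary arc, measured from the corner. -/
def arcX (ω q₁ q₂ θ₁ θ₂ L r : ℝ) : ℝ :=
  -leftRadius ω q₁ q₂ θ₁ θ₂ L * Real.cos θ₁ + arcWidth ω q₁ q₂ L r

/-- Ordinate along the capillary arc, measured from the corner. -/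
def arcY (ω q₁ q₂ θ₁ θ₂ L r : ℝ) : ℝ :=
  leftRadius ω q₁ q₂ θ₁ θ₂ L * Real.sin θ₁ + arcHeight ω q₁ q₂ L r

/-- Area between the capillary arc and the two walls. -/
def arcArea (ω q₁ q₂ θ₁ θ₂ L : ℝ) : ℝ :=
  (1 / 2) * ∫ r in (0 : ℝ)..1,
    (arcY ω q₁ q₂ θ₁ θ₂ L r * Real.cos (arcAngle q₁ q₂ L r) -
      arcX ω q₁ q₂ θ₁ θ₂ L r * Real.sin (arcAngle q₁ q₂ L r)) * arcSpeed ω q₁ q₂ L r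

section Displacement

variable {ω q₁ q₂ θ₁ θ₂ L r : ℝ}

theorem hasDerivAt_arcWidth (hω : 0 < ω) (hL : 0 < L) (hq : max (q₁ ^ 2) (q₂ ^ 2) < 1) :
    HasDerivAt (arcWidth ω q₁ q₂ L)
      (arcSpeed ω q₁ q₂ L r * Real.cos (arcAngle q₁ q₂ L r)) r := by
  have hc : Continuous fun s => arcSpeed ω q₁ q₂ L s * Real.cos (arcAngle q₁ q₂ L s) :=
    (continuous_arcSpeed hω hL hq).mul (Real.continuous_cos.comp continuous_arcAngle)
  exact intervalIntegral.integral_hasDerivAt_right (hc.intervalIntegrable _ _)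
    (hc.stronglyMeasurableAtFilter _ _) hc.continuousAt

theorem hasDerivAt_arcHeight (h₁ : q₁ ≤ 0) (h₂ : q₂ ≤ 0) (hq : max (q₁ ^ 2) (q₂ ^ 2) < 1)
    (hL : 0 < L) (hr : r ∈ Icc (0 : ℝ) 1) (hω : 0 < ω) :
    HasDerivAt (arcHeight ω q₁ q₂ L)
      (arcSpeed ω q₁ q₂ L r * Real.sin (arcAngle q₁ q₂ L r)) r := by
  rw [arcSpeed_mul_sin_arcAngle h₁ h₂ hq hL hr hω]
  exact ((hasDerivAt_coshProfile.sub_const _).const_mul 2).div_const ω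

theorem arcWidth_zero : arcWidth ω q₁ q₂ L 0 = 0 := intervalIntegral.integral_same

theorem arcHeight_zero : arcHeight ω q₁ q₂ L 0 = 0 := by simp [arcHeight]

theorem arcHeight_one (h₁ : q₁ ≤ 0) (h₂ : q₂ ≤ 0) (hq : max (q₁ ^ 2) (q₂ ^ 2) < 1)
    (hL : 0 < L) (hω : 0 < ω) :
    arcHeight ω q₁ q₂ L 1 =
      ∫ s in (0 : ℝ)..1, arcSpeed ω q₁ q₂ L s * Real.sin (arcAngle q₁ q₂ L s) := by
  have hc : Continuous fun s => arcSpeed ω q₁ q₂ L s * Real.sin (arcAngle q₁ q₂ L s) :=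
    (continuous_arcSpeed hω hL hq).mul (Real.continuous_sin.comp continuous_arcAngle)
  rw [intervalIntegral.integral_eq_sub_of_hasDerivAt (f := arcHeight ω q₁ q₂ L)
    (fun r hr => hasDerivAt_arcHeight h₁ h₂ hq hL (by rwa [uIcc_of_le zero_le_one] at hr) hω)
    (hc.intervalIntegrable _ _), arcHeight_zero, sub_zero]

/-- The radii solve, by Cramer's rule, `(W, H) = a (cos θ₁, -sin θ₁) + b (cos θ₂, sin θ₂)` for the
total displacement `(W, H)`. The integral form makes their sign and their growth in `L` visible. -/
theorem leftRadius_eq (h₁ : q₁ ≤ 0) (h₂ : q₂ ≤ 0) (hq : max (q₁ ^ 2) (q₂ ^ 2) < 1)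
    (hL : 0 < L) (hω : 0 < ω) :
    leftRadius ω q₁ q₂ θ₁ θ₂ L = (∫ s in (0 : ℝ)..1,
      arcSpeed ω q₁ q₂ L s * Real.sin (θ₂ - arcAngle q₁ q₂ L s)) / Real.sin (θ₁ + θ₂) := by
  have hv := continuous_arcSpeed hω hL hq
  have hψ := continuous_arcAngle (q₁ := q₁) (q₂ := q₂) (L := L)
  rw [leftRadius, arcHeight_one h₁ h₂ hq hL hω, arcWidth,
    ← intervalIntegral.integral_mul_const, ← intervalIntegral.integral_mul_const,
    ← intervalIntegral.integral_sub]
  · congr 2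
    ext s
    rw [Real.sin_sub]
    ring
  · exact Continuous.intervalIntegrable (by fun_prop) _ _
  · exact Continuous.intervalIntegrable (by fun_prop) _ _

theorem rightRadius_eq (h₁ : q₁ ≤ 0) (h₂ : q₂ ≤ 0) (hq : max (q₁ ^ 2) (q₂ ^ 2) < 1)
    (hL : 0 < L) (hω : 0 < ω) :
    rightRadius ω q₁ q₂ θ₁ θ₂ L = (∫ s in (0 : ℝ)..1,
      arcSpeed ω q₁ q₂ L s * Real.sin (θ₁ + arcAngle q₁ q₂ L s)) / Real.sin (θ₁ + θ₂) := by
  have hv := continuous_arcSpeed hω hL hq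
  have hψ := continuous_arcAngle (q₁ := q₁) (q₂ := q₂) (L := L)
  rw [rightRadius, arcHeight_one h₁ h₂ hq hL hω, arcWidth,
    ← intervalIntegral.integral_mul_const, ← intervalIntegral.integral_mul_const,
    ← intervalIntegral.integral_add]
  · congr 2
    ext s
    rw [Real.sin_add]
    ring
  · exact Continuous.intervalIntegrable (by fun_prop) _ _
  · exact Continuous.intervalIntegrable (by fun_prop) _ _

theorem arcX_one (h : Real.sin (θ₁ + θ₂) ≠ 0) :
    arcX ω q₁ q₂ θ₁ θ₂ L 1 = rightRadius ω q₁ q₂ θ₁ θ₂ L * Real.cos θ₂ := by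
  rw [arcX, leftRadius, rightRadius]
  field_simp
  rw [Real.sin_add]
  ring

theorem arcY_one (h : Real.sin (θ₁ + θ₂) ≠ 0) :
    arcY ω q₁ q₂ θ₁ θ₂ L 1 = rightRadius ω q₁ q₂ θ₁ θ₂ L * Real.sin θ₂ := by
  rw [arcY, leftRadius, rightRadius]
  field_simp
  rw [Real.sin_add]
  ring

theorem continuous_arcArea_exp (hω : 0 < ω) (hq : max (q₁ ^ 2) (q₂ ^ 2) < 1) :
    Continuous fun t => arcArea ω q₁ q₂ θ₁ θ₂ (Real.exp t) := by
  have hv := continuous_arcSpeed_exp (q₁ := q₁) (q₂ := q₂) hω hq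
  have hψ := continuous_arcAngle_exp (q₁ := q₁) (q₂ := q₂)
  have hp := continuous_coshProfile_exp (q₁ := q₁) (q₂ := q₂)
  have hW : Continuous fun z : ℝ × ℝ => arcWidth ω q₁ q₂ (Real.exp z.1) z.2 :=
    intervalIntegral.continuous_parametric_primitive_of_continuous
      (f := fun t s => arcSpeed ω q₁ q₂ (Real.exp t) s * Real.cos (arcAngle q₁ q₂ (Real.exp t) s))
      (hv.mul (Real.continuous_cos.comp hψ))
  have hat {f : ℝ × ℝ → ℝ} (hf : Continuous f) (c : ℝ) : Continuous fun z : ℝ × ℝ => f (z.1, c) :=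
    hf.comp (continuous_fst.prodMk continuous_const)
  have hH : Continuous fun z : ℝ × ℝ => arcHeight ω q₁ q₂ (Real.exp z.1) z.2 :=
    ((hp.sub (hat hp 0)).const_mul 2).div_const ω
  have ha : Continuous fun z : ℝ × ℝ => leftRadius ω q₁ q₂ θ₁ θ₂ (Real.exp z.1) :=
    (((hat hW 1).mul_const _).sub ((hat hH 1).mul_const _)).div_const _
  have hF : Continuous fun z : ℝ × ℝ =>
      (arcY ω q₁ q₂ θ₁ θ₂ (Real.exp z.1) z.2 * Real.cos (arcAngle q₁ q₂ (Real.exp z.1) z.2) -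
        arcX ω q₁ q₂ θ₁ θ₂ (Real.exp z.1) z.2 * Real.sin (arcAngle q₁ q₂ (Real.exp z.1) z.2)) *
        arcSpeed ω q₁ q₂ (Real.exp z.1) z.2 :=
    ((((ha.mul_const _).add hH).mul (Real.continuous_cos.comp hψ)).sub
      (((ha.neg.mul_const _).add hW).mul (Real.continuous_sin.comp hψ))).mul hv
  exact (intervalIntegral.continuous_parametric_intervalIntegral_of_continuous'
    (f := fun t r => (arcY ω q₁ q₂ θ₁ θ₂ (Real.exp t) r * Real.cos (arcAngle q₁ q₂ (Real.exp t) r) -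
      arcX ω q₁ q₂ θ₁ θ₂ (Real.exp t) r * Real.sin (arcAngle q₁ q₂ (Real.exp t) r)) *
      arcSpeed ω q₁ q₂ (Real.exp t) r) hF 0 1).const_mul _

end Displacement

/-! ### Descending contact data -/

/-- Contact angle `α` and wall angles for which the prescribed slope angles `α - θ₁` at the left
wall and `θ₂ - α` at the right wall are both nonpositive. -/
structure DescendingAngles (α θ₁ θ₂ : ℝ) : Prop where
  θ₂_pos : 0 < θ₂
  θ₂_le : θ₂ ≤ α
  le_θ₁ : α ≤ θ₁
  θ₁_lt : θ₁ < Real.pi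
  add_lt : θ₁ + θ₂ < Real.pi

/-- Sine of half the slope angle at the left wall. -/
def leftSine (α θ₁ : ℝ) : ℝ := Real.sin ((α - θ₁) / 2)

/-- Sine of half the slope angle at the right wall. -/
def rightSine (α θ₂ : ℝ) : ℝ := Real.sin ((θ₂ - α) / 2)

namespace DescendingAngles

variable {g σ ω α θ₁ θ₂ L r : ℝ}

theorem sin_add_pos (h : DescendingAngles α θ₁ θ₂) : 0 < Real.sin (θ₁ + θ₂) :=
  Real.sin_pos_of_pos_of_lt_pi (by linarith [h.θ₂_pos, h.θ₂_le, h.le_θ₁]) h.add_lt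

theorem sin_θ₂_pos (h : DescendingAngles α θ₁ θ₂) : 0 < Real.sin θ₂ :=
  Real.sin_pos_of_pos_of_lt_pi h.θ₂_pos (by linarith [h.θ₁_lt, h.θ₂_le, h.le_θ₁])

theorem sin_α_pos (h : DescendingAngles α θ₁ θ₂) : 0 < Real.sin α :=
  Real.sin_pos_of_pos_of_lt_pi (by linarith [h.θ₂_pos, h.θ₂_le])
    (by linarith [h.θ₁_lt, h.le_θ₁])

theorem leftSine_nonpos (h : DescendingAngles α θ₁ θ₂) : leftSine α θ₁ ≤ 0 :=
  Real.sin_nonpos_of_nonpos_of_neg_pi_le (by linarith [h.le_θ₁])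
    (by linarith [h.θ₁_lt, h.θ₂_pos, h.θ₂_le, Real.pi_pos])

theorem rightSine_nonpos (h : DescendingAngles α θ₁ θ₂) : rightSine α θ₂ ≤ 0 :=
  Real.sin_nonpos_of_nonpos_of_neg_pi_le (by linarith [h.θ₂_le])
    (by linarith [h.θ₁_lt, h.θ₂_pos, h.le_θ₁, Real.pi_pos])

theorem max_sq_lt (h : DescendingAngles α θ₁ θ₂) :
    max (leftSine α θ₁ ^ 2) (rightSine α θ₂ ^ 2) < 1 := by
  have hs : ∀ x : ℝ, -(Real.pi / 2) < x → x < Real.pi / 2 → Real.sin x ^ 2 < 1 := fun x h1 h2 => by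
    have := Real.cos_pos_of_mem_Ioo ⟨h1, h2⟩
    nlinarith [Real.sin_sq_add_cos_sq x]
  have := h.θ₂_pos
  have := h.θ₂_le
  have := h.le_θ₁
  have := h.θ₁_lt
  exact max_lt (hs _ (by linarith) (by linarith)) (hs _ (by linarith) (by linarith))

theorem arcsin_leftSine (h : DescendingAngles α θ₁ θ₂) :
    Real.arcsin (leftSine α θ₁) = (α - θ₁) / 2 := by
  have := h.θ₂_pos
  have := h.θ₂_le
  have := h.le_θ₁
  have := h.θ₁_lt
  exact Real.arcsin_sin (by linarith) (by linarith)

theorem arcsin_rightSine (h : DescendingAngles α θ₁ θ₂) :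
    Real.arcsin (rightSine α θ₂) = (θ₂ - α) / 2 := by
  have := h.θ₂_pos
  have := h.θ₂_le
  have := h.le_θ₁
  have := h.θ₁_lt
  exact Real.arcsin_sin (by linarith) (by linarith)

theorem arcAngle_zero (h : DescendingAngles α θ₁ θ₂) (hL : 0 < L) :
    arcAngle (leftSine α θ₁) (rightSine α θ₂) L 0 = α - θ₁ := by
  rw [arcAngle, sinhProfile_zero hL, h.arcsin_leftSine]
  ring

theorem arcAngle_one (h : DescendingAngles α θ₁ θ₂) (hL : 0 < L) :
    arcAngle (leftSine α θ₁) (rightSine α θ₂) L 1 = θ₂ - α := by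
  rw [arcAngle, sinhProfile_one hL, h.arcsin_rightSine]
  ring

theorem arcAngle_mem (h : DescendingAngles α θ₁ θ₂) (hL : 0 < L) (hr : r ∈ Icc (0 : ℝ) 1) :
    arcAngle (leftSine α θ₁) (rightSine α θ₂) L r ∈ Icc (min (α - θ₁) (θ₂ - α)) 0 := by
  constructor
  · have h1 := Real.monotone_arcsin
      (min_le_sinhProfile (q₂ := rightSine α θ₂) h.leftSine_nonpos hL hr)
    rw [Real.monotone_arcsin.map_min, h.arcsin_leftSine, h.arcsin_rightSine] at h1
    rw [arcAngle]
    rcases min_le_iff.1 h1 with h2 | h2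
    · exact min_le_of_left_le (by linarith)
    · exact min_le_of_right_le (by linarith)
  · have h1 := Real.arcsin_nonpos.2 (sinhProfile_nonpos h.leftSine_nonpos h.rightSine_nonpos hL hr)
    rw [arcAngle]
    linarith

/-- For these `ψ` both `θ₂ - ψ` and `θ₁ + ψ` stay in `[θ₂, θ₁]`, a compact part of `(0, π)`, because
`α` and `θ₁ + θ₂ - α` lie there. -/
theorem exists_sin_lower_bound (h : DescendingAngles α θ₁ θ₂) :
    ∃ δ, 0 < δ ∧ ∀ ψ ∈ Icc (min (α - θ₁) (θ₂ - α)) 0,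
      δ ≤ Real.sin (θ₂ - ψ) ∧ δ ≤ Real.sin (θ₁ + ψ) := by
  have := h.θ₂_pos
  have := h.θ₂_le
  have := h.le_θ₁
  have := h.θ₁_lt
  have := h.add_lt
  have hne : (Icc (min (α - θ₁) (θ₂ - α)) 0).Nonempty :=
    nonempty_Icc.2 (min_le_of_left_le (by linarith))
  obtain ⟨z, hz, hmin⟩ := isCompact_Icc.exists_isMinOn hne
    (f := fun ψ => min (Real.sin (θ₂ - ψ)) (Real.sin (θ₁ + ψ))) (by fun_prop)
  refine ⟨_, ?_, fun ψ hψ => le_min_iff.1 (hmin hψ)⟩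
  have hz0 := hz.2
  rcases min_le_iff.1 hz.1 with h1 | h1 <;>
  exact lt_min (Real.sin_pos_of_pos_of_lt_pi (by linarith) (by linarith))
    (Real.sin_pos_of_pos_of_lt_pi (by linarith) (by linarith))

end DescendingAngles

/-! ### Estimates uniform in `L` -/

namespace DescendingAngles

variable {g σ ω α θ₁ θ₂ L r : ℝ}

theorem continuous_speed (h : DescendingAngles α θ₁ θ₂) (hω : 0 < ω) (hL : 0 < L) :
    Continuous (arcSpeed ω (leftSine α θ₁) (rightSine α θ₂) L) :=
  continuous_arcSpeed hω hL h.max_sq_lt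

theorem exists_radius_lower_bound (h : DescendingAngles α θ₁ θ₂) (hω : 0 < ω) :
    ∃ c, 0 < c ∧ ∀ L, 0 < L →
      c * L ≤ leftRadius ω (leftSine α θ₁) (rightSine α θ₂) θ₁ θ₂ L ∧
      c * L ≤ rightRadius ω (leftSine α θ₁) (rightSine α θ₂) θ₁ θ₂ L := by
  obtain ⟨δ, hδ, hδ'⟩ := h.exists_sin_lower_bound
  have hs := h.sin_add_pos
  -- The speed is at least `L / ω` and the sine factor at least `δ`.
  refine ⟨δ / ω / Real.sin (θ₁ + θ₂), by positivity, fun L hL => ?_⟩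
  have hv := h.continuous_speed hω hL
  have hψ := continuous_arcAngle (q₁ := leftSine α θ₁) (q₂ := rightSine α θ₂) (L := L)
  have key : ∀ f : ℝ → ℝ, Continuous f → (∀ r ∈ Icc (0 : ℝ) 1, δ ≤ f r) →
      δ / ω * L ≤ ∫ r in (0 : ℝ)..1, arcSpeed ω (leftSine α θ₁) (rightSine α θ₂) L r * f r := by
    intro f hf hle
    have h1 := intervalIntegral.integral_mono_on (μ := MeasureTheory.volume)
      (f := fun _ => δ / ω * L) zero_le_one
      (continuous_const.intervalIntegrable 0 1) ((hv.mul hf).intervalIntegrable 0 1)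
      (fun r hr => by
        rw [show δ / ω * L = L / ω * δ by ring]
        exact mul_le_mul (div_le_arcSpeed hω hL h.max_sq_lt) (hle r hr) hδ.le
          (arcSpeed_pos hω hL h.max_sq_lt).le)
    simpa using h1
  rw [leftRadius_eq h.leftSine_nonpos h.rightSine_nonpos h.max_sq_lt hL hω,
    rightRadius_eq h.leftSine_nonpos h.rightSine_nonpos h.max_sq_lt hL hω, div_mul_eq_mul_div]
  constructor
  · exact div_le_div_of_nonneg_right (key _ (by fun_prop)
      fun r hr => (hδ' _ (h.arcAngle_mem hL hr)).1) hs.le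
  · exact div_le_div_of_nonneg_right (key _ (by fun_prop)
      fun r hr => (hδ' _ (h.arcAngle_mem hL hr)).2) hs.le

theorem leftRadius_le (h : DescendingAngles α θ₁ θ₂) (hω : 0 < ω) (hL : 0 < L) :
    leftRadius ω (leftSine α θ₁) (rightSine α θ₂) θ₁ θ₂ L ≤
      L / (ω * √(1 - max (leftSine α θ₁ ^ 2) (rightSine α θ₂ ^ 2))) / Real.sin (θ₁ + θ₂) := by
  have hv := h.continuous_speed hω hL
  have hψ := continuous_arcAngle (q₁ := leftSine α θ₁) (q₂ := rightSine α θ₂) (L := L)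
  rw [leftRadius_eq h.leftSine_nonpos h.rightSine_nonpos h.max_sq_lt hL hω]
  refine div_le_div_of_nonneg_right ?_ h.sin_add_pos.le
  have h1 := intervalIntegral.integral_mono_on (μ := MeasureTheory.volume)
    (f := fun r => arcSpeed ω (leftSine α θ₁) (rightSine α θ₂) L r *
      Real.sin (θ₂ - arcAngle (leftSine α θ₁) (rightSine α θ₂) L r))
    (g := fun _ => L / (ω * √(1 - max (leftSine α θ₁ ^ 2) (rightSine α θ₂ ^ 2)))) zero_le_one
    (Continuous.intervalIntegrable (by fun_prop) 0 1) (continuous_const.intervalIntegrable 0 1)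
    (fun r hr => (mul_le_of_le_one_right (arcSpeed_pos hω hL h.max_sq_lt).le
      (Real.sin_le_one _)).trans (arcSpeed_le hω hL h.max_sq_lt))
  simpa using h1

theorem leftRadius_pos (h : DescendingAngles α θ₁ θ₂) (hω : 0 < ω) (hL : 0 < L) :
    0 < leftRadius ω (leftSine α θ₁) (rightSine α θ₂) θ₁ θ₂ L := by
  obtain ⟨c, hc, hc'⟩ := h.exists_radius_lower_bound hω
  exact (mul_pos hc hL).trans_le (hc' L hL).1

theorem rightRadius_pos (h : DescendingAngles α θ₁ θ₂) (hω : 0 < ω) (hL : 0 < L) :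
    0 < rightRadius ω (leftSine α θ₁) (rightSine α θ₂) θ₁ θ₂ L := by
  obtain ⟨c, hc, hc'⟩ := h.exists_radius_lower_bound hω
  exact (mul_pos hc hL).trans_le (hc' L hL).2

/-- Height and curvature are both increasing affine functions of `coshProfile`, so this gives the
descent of the arc and the decrease of its curvature at once. -/
theorem antitoneOn_coshProfile (h : DescendingAngles α θ₁ θ₂) (hL : 0 < L) :
    AntitoneOn (coshProfile (leftSine α θ₁) (rightSine α θ₂) L) (Icc 0 1) := by
  apply antitoneOn_of_deriv_nonpos (convex_Icc 0 1) contDiff_coshProfile.continuous.continuousOn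
    (fun r _ => hasDerivAt_coshProfile.differentiableAt.differentiableWithinAt)
  · intro r hr
    rw [hasDerivAt_coshProfile.deriv]
    exact mul_nonpos_of_nonneg_of_nonpos hL.le
      (sinhProfile_nonpos h.leftSine_nonpos h.rightSine_nonpos hL (interior_subset hr))
  · exact 0

theorem antitoneOn_arcY (h : DescendingAngles α θ₁ θ₂) (hω : 0 < ω) (hL : 0 < L) :
    AntitoneOn (arcY ω (leftSine α θ₁) (rightSine α θ₂) θ₁ θ₂ L) (Icc 0 1) := by
  intro r hr s hs hrs
  have h1 := h.antitoneOn_coshProfile hL hr hs hrs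
  rw [arcY, arcY, arcHeight, arcHeight]
  gcongr

theorem rightRadius_mul_sin_le_arcY (h : DescendingAngles α θ₁ θ₂) (hω : 0 < ω) (hL : 0 < L)
    (hr : r ∈ Icc (0 : ℝ) 1) :
    rightRadius ω (leftSine α θ₁) (rightSine α θ₂) θ₁ θ₂ L * Real.sin θ₂ ≤
      arcY ω (leftSine α θ₁) (rightSine α θ₂) θ₁ θ₂ L r := by
  rw [← arcY_one h.sin_add_pos.ne']
  exact h.antitoneOn_arcY hω hL hr (right_mem_Icc.2 zero_le_one) hr.2

theorem arcY_le_leftRadius (h : DescendingAngles α θ₁ θ₂) (hω : 0 < ω) (hL : 0 < L)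
    (hr : r ∈ Icc (0 : ℝ) 1) :
    arcY ω (leftSine α θ₁) (rightSine α θ₂) θ₁ θ₂ L r ≤
      leftRadius ω (leftSine α θ₁) (rightSine α θ₂) θ₁ θ₂ L := by
  refine (h.antitoneOn_arcY hω hL (left_mem_Icc.2 zero_le_one) hr hr.1).trans ?_
  rw [arcY, arcHeight_zero, add_zero]
  exact mul_le_of_le_one_right (h.leftRadius_pos hω hL).le (Real.sin_le_one _)

theorem arcY_pos (h : DescendingAngles α θ₁ θ₂) (hω : 0 < ω) (hL : 0 < L)
    (hr : r ∈ Icc (0 : ℝ) 1) : 0 < arcY ω (leftSine α θ₁) (rightSine α θ₂) θ₁ θ₂ L r :=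
  (mul_pos (h.rightRadius_pos hω hL) h.sin_θ₂_pos).trans_le (h.rightRadius_mul_sin_le_arcY hω hL hr)

theorem hasDerivAt_arcX (h : DescendingAngles α θ₁ θ₂) (hω : 0 < ω) (hL : 0 < L) :
    HasDerivAt (arcX ω (leftSine α θ₁) (rightSine α θ₂) θ₁ θ₂ L)
      (arcSpeed ω (leftSine α θ₁) (rightSine α θ₂) L r *
        Real.cos (arcAngle (leftSine α θ₁) (rightSine α θ₂) L r)) r :=
  (hasDerivAt_arcWidth hω hL h.max_sq_lt).const_add _

theorem hasDerivAt_arcY (h : DescendingAngles α θ₁ θ₂) (hω : 0 < ω) (hL : 0 < L)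
    (hr : r ∈ Icc (0 : ℝ) 1) :
    HasDerivAt (arcY ω (leftSine α θ₁) (rightSine α θ₂) θ₁ θ₂ L)
      (arcSpeed ω (leftSine α θ₁) (rightSine α θ₂) L r *
        Real.sin (arcAngle (leftSine α θ₁) (rightSine α θ₂) L r)) r :=
  (hasDerivAt_arcHeight h.leftSine_nonpos h.rightSine_nonpos h.max_sq_lt hL hr hω).const_add _

/-- The degenerate case `θ₁ = α = θ₂` of a horizontal segment, which the tangent-line argument must
exclude since it divides by `sin ψ`. -/
theorem arcAngle_eq_zero (h : DescendingAngles α θ₁ θ₂)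
    (hflat : 0 ≤ leftSine α θ₁ + rightSine α θ₂) :
    arcAngle (leftSine α θ₁) (rightSine α θ₂) L r = 0 := by
  have h1 : leftSine α θ₁ = 0 := by linarith [h.leftSine_nonpos, h.rightSine_nonpos]
  have h2 : rightSine α θ₂ = 0 := by linarith [h.leftSine_nonpos, h.rightSine_nonpos]
  simp [arcAngle, sinhProfile, h1, h2]

theorem exists_clockwise_lower_bound (h : DescendingAngles α θ₁ θ₂) (hω : 0 < ω) :
    ∃ c, 0 < c ∧ ∀ L, 0 < L → ∀ r ∈ Icc (0 : ℝ) 1,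
      0 < arcY ω (leftSine α θ₁) (rightSine α θ₂) θ₁ θ₂ L r *
          Real.cos (arcAngle (leftSine α θ₁) (rightSine α θ₂) L r) -
        arcX ω (leftSine α θ₁) (rightSine α θ₂) θ₁ θ₂ L r *
          Real.sin (arcAngle (leftSine α θ₁) (rightSine α θ₂) L r) ∧
      c * L * -Real.sin (arcAngle (leftSine α θ₁) (rightSine α θ₂) L r) ≤
        arcY ω (leftSine α θ₁) (rightSine α θ₂) θ₁ θ₂ L r *
          Real.cos (arcAngle (leftSine α θ₁) (rightSine α θ₂) L r) -
        arcX ω (leftSine α θ₁) (rightSine α θ₂) θ₁ θ₂ L r *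
          Real.sin (arcAngle (leftSine α θ₁) (rightSine α θ₂) L r) := by
  obtain ⟨c, hc, hc'⟩ := h.exists_radius_lower_bound hω
  have hα := h.sin_α_pos
  -- The arc meets both walls at the angle `α`, so at each end the quantity to be bounded equals the
  -- radius times `sin α`.
  refine ⟨c * Real.sin α, by positivity, fun L hL => ?_⟩
  rcases lt_or_ge (leftSine α θ₁ + rightSine α θ₂) 0 with hneg | hflat
  · refine clockwise_lower_bound (v := arcSpeed ω (leftSine α θ₁) (rightSine α θ₂) L)
      (k := fun r => 2 * ω * coshProfile (leftSine α θ₁) (rightSine α θ₂) L r)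
      (fun r _ => (h.hasDerivAt_arcX hω hL).hasDerivWithinAt)
      (fun r hr => (h.hasDerivAt_arcY hω hL hr).hasDerivWithinAt)
      (fun r hr => (hasDerivAt_arcAngle h.leftSine_nonpos h.rightSine_nonpos h.max_sq_lt hL hr
        hω).hasDerivWithinAt)
      (fun r _ => arcSpeed_pos hω hL h.max_sq_lt) (fun r hr => h.arcY_pos hω hL hr)
      ?_ ?_ ?_ (by positivity) ?_ ?_
    · intro r hr s hs hrs
      exact mul_le_mul_of_nonneg_left (h.antitoneOn_coshProfile hL hr hs hrs) (by positivity)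
    · intro r hr
      have h1 := h.arcAngle_mem hL hr
      have := h.θ₂_pos
      have := h.θ₂_le
      have := h.le_θ₁
      have := h.θ₁_lt
      exact ⟨(lt_min (by linarith) (by linarith)).trans_le h1.1, h1.2⟩
    · intro r hr
      have h1 := Real.arcsin_lt_zero.2
        (sinhProfile_neg h.leftSine_nonpos h.rightSine_nonpos hneg hL hr)
      rw [arcAngle]
      linarith
    · rw [h.arcAngle_zero hL, arcX, arcY, arcWidth_zero, arcHeight_zero, add_zero, add_zero,
        Real.cos_sub, Real.sin_sub]
      have h1 := mul_le_mul_of_nonneg_right (hc' L hL).1 hα.le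
      have h2 := Real.sin_sq_add_cos_sq θ₁
      linear_combination h1 -
        leftRadius ω (leftSine α θ₁) (rightSine α θ₂) θ₁ θ₂ L * Real.sin α * h2
    · rw [h.arcAngle_one hL, arcX_one h.sin_add_pos.ne', arcY_one h.sin_add_pos.ne',
        Real.cos_sub, Real.sin_sub]
      have h1 := mul_le_mul_of_nonneg_right (hc' L hL).2 hα.le
      have h2 := Real.sin_sq_add_cos_sq θ₂
      linear_combination h1 -
        rightRadius ω (leftSine α θ₁) (rightSine α θ₂) θ₁ θ₂ L * Real.sin α * h2
  · intro r hr
    have h1 := h.arcY_pos hω hL hr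
    simp [h.arcAngle_eq_zero hflat, h1, h1.le]

/-- The multiplier is forced: the curvature is `2 ω p` and `y = a sin θ₁ + 2 (p - p 0) / ω` with `p
= coshProfile` and `a` the left radius, so `ω² (y - P / g) = 2 ω p` determines `P`. -/
theorem capillaryArc (h : DescendingAngles α θ₁ θ₂) (hω : 0 < ω) (hL : 0 < L) (hσ : 0 < σ)
    (hg : g = ω ^ 2 * σ) :
    CapillaryArc g σ α θ₁ θ₂
      (g * (leftRadius ω (leftSine α θ₁) (rightSine α θ₂) θ₁ θ₂ L * Real.sin θ₁ -
        2 * coshProfile (leftSine α θ₁) (rightSine α θ₂) L 0 / ω))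
      (arcX ω (leftSine α θ₁) (rightSine α θ₂) θ₁ θ₂ L)
      (arcY ω (leftSine α θ₁) (rightSine α θ₂) θ₁ θ₂ L)
      (arcAngle (leftSine α θ₁) (rightSine α θ₂) L)
      (arcSpeed ω (leftSine α θ₁) (rightSine α θ₂) L) := by
  have h₁ := h.leftSine_nonpos
  have h₂ := h.rightSine_nonpos
  have hq := h.max_sq_lt
  obtain ⟨c, -, hc⟩ := h.exists_clockwise_lower_bound hω
  have hU : UniqueDiffOn ℝ (Icc (0 : ℝ) 1) := uniqueDiffOn_Icc one_pos
  refine ⟨?_, ?_, contDiffOn_arcAngle h₁ h₂ hq hL, contDiffOn_arcSpeed h₁ h₂ hq hL hω,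
    fun r _ => (h.hasDerivAt_arcX hω hL).hasDerivWithinAt,
    fun r hr => (h.hasDerivAt_arcY hω hL hr).hasDerivWithinAt, ?_,
    fun r _ => arcSpeed_pos hω hL hq, fun r hr => h.arcY_pos hω hL hr,
    fun r hr => (hc L hL r hr).1,
    ⟨_, h.leftRadius_pos hω hL, ?_, ?_⟩,
    ⟨_, h.rightRadius_pos hω hL, arcX_one h.sin_add_pos.ne', arcY_one h.sin_add_pos.ne'⟩,
    h.arcAngle_zero hL, h.arcAngle_one hL⟩
  · rw [show (2 : WithTop ℕ∞) = 1 + 1 from one_add_one_eq_two.symm,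
      contDiffOn_succ_iff_derivWithin hU]
    refine ⟨fun r _ => (h.hasDerivAt_arcX hω hL).differentiableAt.differentiableWithinAt,
      by simp, ?_⟩
    refine ContDiffOn.congr ((contDiffOn_arcSpeed h₁ h₂ hq hL hω).mul
      (contDiffOn_arcAngle h₁ h₂ hq hL).cos) fun r hr => ?_
    exact (h.hasDerivAt_arcX hω hL).hasDerivWithinAt.derivWithin (hU r hr)
  · have : ContDiff ℝ 2 (coshProfile (leftSine α θ₁) (rightSine α θ₂) L) := contDiff_coshProfile
    unfold arcY arcHeight
    fun_prop
  · intro r hr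
    refine (hasDerivAt_arcAngle h₁ h₂ hq hL hr hω).hasDerivWithinAt.congr_deriv ?_
    rw [arcY, arcHeight, hg]
    field_simp
    ring
  · rw [arcX, arcWidth_zero, add_zero]
  · rw [arcY, arcHeight_zero, add_zero]

/-! ### The area as a function of `L` -/

theorem continuous_area_integrand (h : DescendingAngles α θ₁ θ₂) (hω : 0 < ω) (hL : 0 < L) :
    Continuous fun r => (arcY ω (leftSine α θ₁) (rightSine α θ₂) θ₁ θ₂ L r *
          Real.cos (arcAngle (leftSine α θ₁) (rightSine α θ₂) L r) -
        arcX ω (leftSine α θ₁) (rightSine α θ₂) θ₁ θ₂ L r *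
          Real.sin (arcAngle (leftSine α θ₁) (rightSine α θ₂) L r)) *
        arcSpeed ω (leftSine α θ₁) (rightSine α θ₂) L r := by
  have hv := h.continuous_speed hω hL
  have hψ := continuous_arcAngle (q₁ := leftSine α θ₁) (q₂ := rightSine α θ₂) (L := L)
  have hX : Continuous (arcX ω (leftSine α θ₁) (rightSine α θ₂) θ₁ θ₂ L) :=
    continuous_iff_continuousAt.2 fun r => (h.hasDerivAt_arcX hω hL).continuousAt
  have hp := (contDiff_coshProfile (q₁ := leftSine α θ₁) (q₂ := rightSine α θ₂) (L := L)
    (n := 0)).continuous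
  have hY : Continuous (arcY ω (leftSine α θ₁) (rightSine α θ₂) θ₁ θ₂ L) := by
    unfold arcY arcHeight
    fun_prop
  fun_prop

theorem exists_area_upper_bound (h : DescendingAngles α θ₁ θ₂) (hω : 0 < ω) :
    ∃ C, 0 < C ∧ ∀ L, 0 < L →
      arcArea ω (leftSine α θ₁) (rightSine α θ₂) θ₁ θ₂ L ≤ C * L ^ 2 := by
  have hs := h.sin_add_pos
  have hK : 0 < √(1 - max (leftSine α θ₁ ^ 2) (rightSine α θ₂ ^ 2)) :=
    Real.sqrt_pos.2 (sub_pos.2 h.max_sq_lt)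
  set B := 1 / (ω * √(1 - max (leftSine α θ₁ ^ 2) (rightSine α θ₂ ^ 2))) with hB
  have hBpos : 0 < B := by positivity
  -- `B L` bounds the speed and the horizontal displacement, `B L / sin (θ₁ + θ₂)` the left radius
  -- and the height; the factor `1/2` of the area is given away.
  refine ⟨(2 / Real.sin (θ₁ + θ₂) + 1) * B ^ 2, by positivity, fun L hL => ?_⟩
  have hv := h.continuous_speed hω hL
  have hspeed : ∀ r, arcSpeed ω (leftSine α θ₁) (rightSine α θ₂) L r ≤ B * L := fun r =>
    (arcSpeed_le hω hL h.max_sq_lt).trans_eq (by rw [hB]; ring)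
  have hrad : leftRadius ω (leftSine α θ₁) (rightSine α θ₂) θ₁ θ₂ L ≤
      B * L / Real.sin (θ₁ + θ₂) :=
    (h.leftRadius_le hω hL).trans_eq (by rw [hB]; ring)
  have hrad0 := h.leftRadius_pos hω hL
  have hX : ∀ r ∈ Icc (0 : ℝ) 1, |arcX ω (leftSine α θ₁) (rightSine α θ₂) θ₁ θ₂ L r| ≤
      B * L / Real.sin (θ₁ + θ₂) + B * L := by
    intro r hr
    rw [arcX]
    refine (abs_add_le _ _).trans (add_le_add ?_ ?_)
    · rw [neg_mul, abs_neg, abs_mul, abs_of_pos hrad0]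
      exact (mul_le_of_le_one_right hrad0.le (Real.abs_cos_le_one _)).trans hrad
    · have h1 := intervalIntegral.norm_integral_le_of_norm_le_const (a := 0) (b := r)
        (f := fun s => arcSpeed ω (leftSine α θ₁) (rightSine α θ₂) L s *
          Real.cos (arcAngle (leftSine α θ₁) (rightSine α θ₂) L s)) (C := B * L) (fun s _ => by
          rw [Real.norm_eq_abs, abs_mul, abs_of_pos (arcSpeed_pos hω hL h.max_sq_lt)]
          exact (mul_le_of_le_one_right (arcSpeed_pos hω hL h.max_sq_lt).le
            (Real.abs_cos_le_one _)).trans (hspeed s))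
      refine h1.trans (mul_le_of_le_one_right (by positivity) ?_)
      rw [sub_zero, abs_of_nonneg hr.1]
      exact hr.2
  have h1 := intervalIntegral.integral_mono_on (μ := MeasureTheory.volume)
    (g := fun _ => (2 * (B * L / Real.sin (θ₁ + θ₂)) + B * L) * (B * L)) zero_le_one
    ((h.continuous_area_integrand hω hL).intervalIntegrable 0 1)
    (continuous_const.intervalIntegrable 0 1) (fun r hr => by
      refine mul_le_mul ?_ (hspeed r) (arcSpeed_pos hω hL h.max_sq_lt).le (by positivity)
      have hy0 := h.arcY_pos hω hL hr
      have hy := (h.arcY_le_leftRadius hω hL hr).trans hrad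
      have h2 := mul_le_of_le_one_right hy0.le
        (Real.cos_le_one (arcAngle (leftSine α θ₁) (rightSine α θ₂) L r))
      have h3 := (neg_le_abs (arcX ω (leftSine α θ₁) (rightSine α θ₂) θ₁ θ₂ L r *
        Real.sin (arcAngle (leftSine α θ₁) (rightSine α θ₂) L r)))
      rw [abs_mul] at h3
      have h4 := mul_le_of_le_one_right
        (abs_nonneg (arcX ω (leftSine α θ₁) (rightSine α θ₂) θ₁ θ₂ L r))
        (Real.abs_sin_le_one (arcAngle (leftSine α θ₁) (rightSine α θ₂) L r))
      have h5 := hX r hr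
      linarith)
  rw [intervalIntegral.integral_const, sub_zero, one_smul] at h1
  rw [arcArea]
  have h2 : 0 ≤ (2 * (B * L / Real.sin (θ₁ + θ₂)) + B * L) * (B * L) := by positivity
  have h3 : (2 * (B * L / Real.sin (θ₁ + θ₂)) + B * L) * (B * L) =
      (2 / Real.sin (θ₁ + θ₂) + 1) * B ^ 2 * L ^ 2 := by ring
  linarith

/-- Integrating `F ≥ c L (-sin ψ)` against the speed gives `c L` times the total descent, which does
not degenerate for large `L`. A horizontal segment has no descent; there the area is bounded
directly by height times width. -/
theorem exists_area_lower_bound (h : DescendingAngles α θ₁ θ₂) (hω : 0 < ω) :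
    ∃ c, 0 < c ∧ ∀ L, 2 ≤ L →
      c * L ≤ arcArea ω (leftSine α θ₁) (rightSine α θ₂) θ₁ θ₂ L := by
  rcases lt_or_ge (leftSine α θ₁ + rightSine α θ₂) 0 with hneg | hflat
  · obtain ⟨c, hc, hc'⟩ := h.exists_clockwise_lower_bound hω
    have hd : 0 < -leftSine α θ₁ - rightSine α θ₂ := by linarith
    refine ⟨c * (-leftSine α θ₁ - rightSine α θ₂) / ω / 2, by positivity, fun L hL2 => ?_⟩
    have hL : 0 < L := by linarith
    have hv := h.continuous_speed hω hL
    have hψ := continuous_arcAngle (q₁ := leftSine α θ₁) (q₂ := rightSine α θ₂) (L := L)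
    have h1 := intervalIntegral.integral_mono_on (μ := MeasureTheory.volume)
      (f := fun r => -(c * L) * (arcSpeed ω (leftSine α θ₁) (rightSine α θ₂) L r *
        Real.sin (arcAngle (leftSine α θ₁) (rightSine α θ₂) L r))) zero_le_one
      (Continuous.intervalIntegrable (by fun_prop) 0 1)
      ((h.continuous_area_integrand hω hL).intervalIntegrable 0 1)
      (fun r hr => by
        have h2 := mul_le_mul_of_nonneg_right (hc' L hL r hr).2
          (arcSpeed_pos (r := r) hω hL h.max_sq_lt).le
        linarith)
    rw [intervalIntegral.integral_const_mul, ← arcHeight_one h.leftSine_nonpos h.rightSine_nonpos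
      h.max_sq_lt hL hω] at h1
    have hsinh : 0 < Real.sinh L := Real.sinh_pos_iff.2 hL
    -- Here `cosh L - 1 > sinh L - 1 ≥ sinh L / 2`, because `sinh L ≥ L ≥ 2`.
    have h2 : 1 / 2 ≤ (Real.cosh L - 1) / Real.sinh L := by
      rw [le_div_iff₀ hsinh]
      have := Real.sinh_lt_cosh L
      have := Real.self_le_sinh_iff.2 hL.le
      linarith
    have h3 : arcHeight ω (leftSine α θ₁) (rightSine α θ₂) L 1 ≤
        -((-leftSine α θ₁ - rightSine α θ₂) / ω) := by
      have h4 := coshProfile_zero_sub_one (q₁ := leftSine α θ₁) (q₂ := rightSine α θ₂) (L := L)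
      have h5 := mul_le_mul_of_nonneg_left h2 hd.le
      rw [arcHeight, ← neg_div]
      refine div_le_div_of_nonneg_right ?_ hω.le
      linarith
    have h6 := mul_le_mul_of_nonneg_left h3 (mul_pos hc hL).le
    rw [arcArea]
    have h7 : c * (-leftSine α θ₁ - rightSine α θ₂) / ω / 2 * L =
      1 / 2 * (c * L * ((-leftSine α θ₁ - rightSine α θ₂) / ω)) := by ring
    linarith
  · obtain ⟨c, hc, hc'⟩ := h.exists_radius_lower_bound hω
    have hs := h.sin_θ₂_pos
    refine ⟨c * Real.sin θ₂ / ω, by positivity, fun L hL2 => ?_⟩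
    have hL : 0 < L := by linarith
    have h1 := intervalIntegral.integral_mono_on (μ := MeasureTheory.volume)
      (f := fun r => c * L * Real.sin θ₂ * (L / ω)) zero_le_one
      (continuous_const.intervalIntegrable 0 1)
      ((h.continuous_area_integrand hω hL).intervalIntegrable 0 1)
      (fun r hr => by
        rw [h.arcAngle_eq_zero hflat, Real.cos_zero, Real.sin_zero, mul_one, mul_zero, sub_zero]
        exact mul_le_mul ((mul_le_mul_of_nonneg_right (hc' L hL).2 hs.le).trans
          (h.rightRadius_mul_sin_le_arcY hω hL hr)) (div_le_arcSpeed hω hL h.max_sq_lt)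
          (by positivity) (h.arcY_pos hω hL hr).le)
    rw [intervalIntegral.integral_const, sub_zero, one_smul] at h1
    rw [arcArea]
    -- The bound is quadratic in `L`; one factor `L ≥ 2` is spent on the `1/2` in the area.
    have h2 : c * Real.sin θ₂ / ω * L * 2 ≤ c * Real.sin θ₂ / ω * L * L :=
      mul_le_mul_of_nonneg_left hL2 (by positivity)
    have h3 : c * L * Real.sin θ₂ * (L / ω) = c * Real.sin θ₂ / ω * L * L := by ring
    linarith

theorem exists_area_eq (h : DescendingAngles α θ₁ θ₂) (hω : 0 < ω) {V : ℝ} (hV : 0 < V) :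
    ∃ L, 0 < L ∧ arcArea ω (leftSine α θ₁) (rightSine α θ₂) θ₁ θ₂ L = V := by
  obtain ⟨C, hC, hC'⟩ := h.exists_area_upper_bound hω
  obtain ⟨c, hc, hc'⟩ := h.exists_area_lower_bound hω
  have hcont := continuous_arcArea_exp (θ₁ := θ₁) (θ₂ := θ₂) hω h.max_sq_lt
  have hsmall : ∃ t, arcArea ω (leftSine α θ₁) (rightSine α θ₂) θ₁ θ₂ (Real.exp t) ≤ V := by
    -- Chosen so that the upper bound `C L²` equals `V`.
    refine ⟨Real.log √(V / C), (hC' _ (Real.exp_pos _)).trans_eq ?_⟩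
    rw [Real.exp_log (Real.sqrt_pos.2 (by positivity)), Real.sq_sqrt (by positivity)]
    field_simp
  have hlarge : ∃ t, V ≤ arcArea ω (leftSine α θ₁) (rightSine α θ₂) θ₁ θ₂ (Real.exp t) := by
    have hm : 0 < max 2 (V / c) := lt_max_of_lt_left two_pos
    refine ⟨Real.log (max 2 (V / c)), ?_⟩
    rw [Real.exp_log hm]
    refine le_trans ?_ (hc' _ (le_max_left _ _))
    rw [← div_le_iff₀' hc]
    exact le_max_right _ _
  obtain ⟨t, ht⟩ := mem_range_of_exists_le_of_exists_ge hcont hsmall hlarge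
  exact ⟨Real.exp t, Real.exp_pos t, ht⟩

theorem exists_steadyState (h : DescendingAngles α θ₁ θ₂) (hg : 0 < g) (hσ : 0 < σ) {κ V : ℝ}
    (hκ : Real.cos α = κ / σ) (hV : 0 < V) :
    ∃ (P₀ : ℝ) (ρ : ℝ → ℝ), IsSteadyState g σ κ θ₁ θ₂ P₀ ρ ∧ volume θ₁ θ₂ ρ = V := by
  have hω : 0 < √(g / σ) := Real.sqrt_pos.2 (by positivity)
  obtain ⟨L, hL, hLV⟩ := h.exists_area_eq hω hV
  have hω2 : g = √(g / σ) ^ 2 * σ := by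
    rw [Real.sq_sqrt (by positivity)]
    field_simp
  obtain ⟨ρ, hρ, hvol⟩ := (h.capillaryArc hω hL hσ hω2).exists_steadyState hσ hκ
    ⟨by linarith [h.θ₂_pos, h.θ₂_le, h.le_θ₁], h.θ₁_lt⟩
    ⟨h.θ₂_pos, by linarith [h.θ₁_lt, h.θ₂_le, h.le_θ₁]⟩
  exact ⟨_, ρ, hρ, hvol.trans hLV⟩

end DescendingAngles

/-! ### Reflection exchanging the two walls -/

section Reflection

variable {g σ κ θ₁ θ₂ P₀ : ℝ} {ρ : ℝ → ℝ}

theorem derivWithin_reflect (f : ℝ → ℝ) (θ : ℝ) :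
    derivWithin (fun θ => f (Real.pi - θ)) (vesselAngles θ₂ θ₁) θ =
      -derivWithin f (vesselAngles θ₁ θ₂) (Real.pi - θ) := by
  rw [derivWithin_comp_const_sub, vesselAngles, vesselAngles, neg_Icc, vadd_Icc]
  simp [sub_eq_add_neg]

theorem lengthElement_reflect (θ : ℝ) :
    lengthElement θ₂ θ₁ (fun θ => ρ (Real.pi - θ)) θ = lengthElement θ₁ θ₂ ρ (Real.pi - θ) := by
  rw [lengthElement, lengthElement, radialDeriv, radialDeriv, derivWithin_reflect, neg_sq]

theorem radialSlope_reflect (θ : ℝ) :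
    radialSlope θ₂ θ₁ (fun θ => ρ (Real.pi - θ)) θ = -radialSlope θ₁ θ₂ ρ (Real.pi - θ) := by
  rw [radialSlope, radialSlope, lengthElement_reflect, radialDeriv, radialDeriv,
    derivWithin_reflect, neg_div]

/-- Under `θ ↦ π - θ` the sine is invariant and the radial slope changes sign. The sign cancels on
differentiating once more, and it turns each wall condition into the other. -/
theorem IsSteadyState.reflect (h : IsSteadyState g σ κ θ₁ θ₂ P₀ ρ) :
    IsSteadyState g σ κ θ₂ θ₁ P₀ fun θ => ρ (Real.pi - θ) := by
  have hm : MapsTo (fun θ => Real.pi - θ) (vesselAngles θ₂ θ₁) (vesselAngles θ₁ θ₂) :=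
    fun θ hθ => ⟨by linarith [hθ.2], by linarith [hθ.1]⟩
  refine ⟨fun θ hθ => h.pos _ (hm hθ), h.contDiffOn.comp (by fun_prop) hm, ?_, ?_, ?_⟩
  · intro θ hθ
    have h1 : radialSlope θ₂ θ₁ (fun θ => ρ (Real.pi - θ)) =
        fun θ => (-radialSlope θ₁ θ₂ ρ) (Real.pi - θ) := funext radialSlope_reflect
    rw [lengthElement_reflect, h1, derivWithin_reflect, derivWithin.neg, neg_neg,
      ← Real.sin_pi_sub θ]
    exact h.euler_lagrange _ (hm hθ)
  · rw [radialSlope_reflect, h.left_wall]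
  · rw [radialSlope_reflect, sub_sub_cancel, h.right_wall, neg_neg]

theorem volume_reflect : volume θ₂ θ₁ (fun θ => ρ (Real.pi - θ)) = volume θ₁ θ₂ ρ := by
  rw [volume, volume, intervalIntegral.integral_comp_sub_left (fun θ => ρ θ ^ 2) Real.pi,
    sub_sub_cancel]

end Reflection

end InclinedWalls

end

/-! ### Assembly -/

theorem theorem3p16 (g σ κ θ₁ θ₂ V : ℝ) (hg : 0 < g) (hσ : 0 < σ)
    (hκ : -1 ≤ κ / σ ∧ κ / σ ≤ 1)
    (hθ₁ : θ₁ ∈ Ioo 0 Real.pi) (hθ₂ : θ₂ ∈ Ioo 0 Real.pi) (hθ : θ₁ + θ₂ < Real.pi)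
    (hsign : 0 ≤ InclinedWalls.leftContactAngle σ κ θ₁ * InclinedWalls.rightContactAngle σ κ θ₂)
    (hV : 0 < V) :
    ∃ (P₀ : ℝ) (ρ : ℝ → ℝ),
      InclinedWalls.IsSteadyState g σ κ θ₁ θ₂ P₀ ρ ∧ InclinedWalls.volume θ₁ θ₂ ρ = V := by
  have hcos : Real.cos (InclinedWalls.wettingAngle σ κ + Real.pi / 2) = κ / σ := by
    rw [Real.cos_add_pi_div_two, InclinedWalls.wettingAngle, neg_div,
      Real.sin_arcsin (by linarith [hκ.2]) (by linarith [hκ.1]), neg_neg]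
  rw [InclinedWalls.leftContactAngle, InclinedWalls.rightContactAngle] at hsign
  rcases mul_nonneg_iff.1 hsign with ⟨h₁, h₂⟩ | ⟨h₁, h₂⟩
  -- Both slope angles are nonnegative: the arc ascends, and the mirrored wedge carries a descending
  -- one.
  · have h : InclinedWalls.DescendingAngles (InclinedWalls.wettingAngle σ κ + Real.pi / 2) θ₂ θ₁ :=
      ⟨hθ₁.1, by linarith, by linarith, hθ₂.2, by linarith⟩
    obtain ⟨P₀, ρ, hρ, hvol⟩ := h.exists_steadyState hg hσ hcos hV
    exact ⟨P₀, _, hρ.reflect, InclinedWalls.volume_reflect.trans hvol⟩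
  · have h : InclinedWalls.DescendingAngles (InclinedWalls.wettingAngle σ κ + Real.pi / 2) θ₁ θ₂ :=
      ⟨hθ₂.1, by linarith, by linarith, hθ₁.2, hθ⟩
    exact h.exists_steadyState hg hσ hcos hV
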